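/- A \emph{restricted combinatorial mobile sensor network} (RCMSN) of $n$ sensors $1,\dots,n$ is a sequence $s_1,\dots,s_L$, $L=\binom n2$, of distinct two-element subsets of $\{1,\dots,n\}$ (packets). A packet $s_{k_1}$ \emph{can reach} sensor $x$ if for some $m\ge 1$ there are indices $k_1<k_2<\cdots<k_m\le L$ with $s_{k_j}\cap s_{k_{j-1}}\neq\emptyset$ for $2\le j\le m$ and $x\in s_{k_m}$. The \emph{capacity} of the RCMSN is \[\frac1{nL}\sum_{k=1}^{L}\#\{x : 1\le x\le n,\ s_k\text{ can reach }x\}.\] Given $n$ nonvertical lines in the plane with pairwise distinct slopes such that no two of their $\binom n2$ pairwise intersections have the same $x$-coordinate, the \emph{geometric mobile sensor network} (GMSN) they form is the RCMSN obtained by sorting the pairs $\{i,j\}$, $1\le i<j\le n$, in ascending order of the $x$-coordinate of the intersection of line $i$ and line $j$. \textbf{Theorem (Expectation for GMSN).} Let $a^-<a^+$ and $b^-<b^+$ be real numbers. For each $n$ let $(a_k,b_k)$, $1\le k\le n$, be independent and uniformly distributed on $[a^-,a^+]\times[b^-,b^+]$, and let the $k$th sensor be represented by the line $y=a_kx+b_k$.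 Then almost surely these lines form a (unique) GMSN, its capacity is an integrable random variable, and its expected capacity tends to $5/6$ as $n\to\infty$. -/

import Mathlib

open MeasureTheory ProbabilityTheory Filter Topology

/-- A combinatorial mobile sensor network of `n` sensors and length `L`: a sequence of `L` packets,
each a two-element set of sensors. -/
@[ext]
structure CMSN (n L : ℕ) where
  packet : Fin L → Finset (Fin n)
  card_packet : ∀ k, (packet k).card = 2

namespace CMSN

variable {n L : ℕ}

/-- The `k`-th packet can reach the sensor `x`: there are indices `k = c 0 < c 1 < ⋯ < c m` such
that consecutive packets share a sensor and `x` belongs to the last packet. -/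
def CanReach (N : CMSN n L) (k : Fin L) (x : Fin n) : Prop :=
  ∃ (m : ℕ) (c : Fin (m + 1) → Fin L), c 0 = k ∧ StrictMono c ∧
    (∀ j : Fin m, (N.packet (c j.succ) ∩ N.packet (c j.castSucc)).Nonempty) ∧
    x ∈ N.packet (c (Fin.last m))

/-- The number of deliveries divided by `n * L`. -/
noncomputable def capacity (N : CMSN n L) : ℝ :=
  1 / ((n : ℝ) * (L : ℝ)) * ∑ k : Fin L, (Set.ncard {x : Fin n | N.CanReach k x} : ℝ)

end CMSN

/-- A restricted combinatorial mobile sensor network of `n` sensors: a sequence of `n.choose 2`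
distinct packets, so that every pair of sensors occurs exactly once. -/
@[ext]
structure RCMSN (n : ℕ) extends CMSN n (n.choose 2) where
  packet_injective : Function.Injective packet

/-- The `x`-coordinate of the intersection of the lines `y = p.1 * x + p.2` and
`y = q.1 * x + q.2`; it is used for lines of different slopes only
(see `crossing_eq_iff`). -/
noncomputable def crossing (p q : ℝ × ℝ) : ℝ := (q.2 - p.2) / (p.1 - q.1)

theorem crossing_eq_iff {p q : ℝ × ℝ} (h : p.1 ≠ q.1) (x : ℝ) :
    crossing p q = x ↔ p.1 * x + p.2 = q.1 * x + q.2 := by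
  have h' : p.1 - q.1 ≠ 0 := sub_ne_zero.mpr h
  unfold crossing
  rw [div_eq_iff h']
  constructor <;> intro h <;> linarith

/-- `N` is the geometric mobile sensor network given by the lines `y = (ℓ i).1 * x + (ℓ i).2`:
the slopes are distinct, no two of the intersections have the same `x`-coordinate, and `N` lists
all pairs `{i, j}` in ascending order of the `x`-coordinate of the intersection of line `i` and
line `j`. -/
structure IsGMSN {n : ℕ} (ℓ : Fin n → ℝ × ℝ) (N : RCMSN n) : Prop where
  slope_injective : Function.Injective fun i => (ℓ i).1
  crossing_injective : ∀ i j i' j' : Fin n, i ≠ j → i' ≠ j' →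
    crossing (ℓ i) (ℓ j) = crossing (ℓ i') (ℓ j') → ({i, j} : Finset (Fin n)) = {i', j'}
  sorted : ∀ s t : Fin (n.choose 2), s < t → ∀ i j i' j' : Fin n,
    N.packet s = {i, j} → N.packet t = {i', j'} →
    crossing (ℓ i) (ℓ j) < crossing (ℓ i') (ℓ j')

open Classical in
/-- The capacity of the geometric mobile sensor network formed by the lines `ℓ`; the value is `0`
by convention if the lines do not form one. -/
noncomputable def gmsnCapacity {n : ℕ} (ℓ : Fin n → ℝ × ℝ) : ℝ :=
  if h : ∃ N : RCMSN n, IsGMSN ℓ N then h.choose.capacity else 0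

/-!
The expected capacity is the average, over ordered pairs of distinct sensors `i`, `j` and over
sensors `x`, of the probability that the packet `{i, j}` can reach `x`. The lines being independent
and identically distributed, this probability for `x ∉ {i, j}` is governed by the triple of lines
`i`, `j`, `x` alone, up to an error that vanishes as `n → ∞`.

Let `(x₀, y₀)` be the crossing of the lines `i` and `j`, and let `v` be the intercept of the line
through `(x₀, y₀)` that is parallel to line `x`.

* If `x₀ > 0` and `v` is outside `(bMin, bMax)`, then `x` is never reached
  (`IsGMSN.lt_interceptThrough_of_canReach`): all messages remain below the line through `(x₀, y₀)`
  with intercept `bMin`, so they only visit lines of smaller slope than that line has; the same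
  holds upside down with `bMax`.
* Otherwise a chain of at most three packets leads to `x` as soon as a suitable relay line exists
  (`IsGMSN.canReach_direct`, `IsGMSN.canReach_relay`). Suitable lines form a set of positive
  probability (`ae_isRelay_pos`), so one of the `n - 3` remaining lines is a relay with probability
  tending to one (`tendsto_noRelayProb`).

It remains to see that the first case has probability `1 / 6` (`measure_unreachable`). Reflecting
the slopes changes the sign of `x₀` and keeps `v`, so this is half the probability of `v` being
outside `(bMin, bMax)`. Now `v` is the value at the slope `a₃` of line `x` of the affine function
taking the independent uniform values `b₁`, `b₂` at the slopes `a₁`, `a₂`. For fixed slopes the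
probability that it is inside `(bMin, bMax)` is `|a₁ - a₂|` divided by the length of the hull of
`a₁`, `a₂`, `a₃` (`uniform_extrapolate`). The three ratios of this kind add up to `2`, so each of
them has mean `2 / 3` (`lintegral_relDist`), and the limit is `1 - (1 - 2 / 3) / 2 = 5 / 6`.
-/

/-! ### Crossings of lines -/

theorem crossing_comm (p q : ℝ × ℝ) : crossing p q = crossing q p := by
  unfold crossing
  rw [← neg_sub p.2 q.2, ← neg_sub q.1 p.1, neg_div_neg_eq]

theorem height_crossing {p q : ℝ × ℝ} (h : p.1 ≠ q.1) :
    p.1 * crossing p q + p.2 = q.1 * crossing p q + q.2 :=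
  (crossing_eq_iff h _).1 rfl

/-- A line that is above another one at `x` and has the smaller slope meets it after `x`. -/
theorem lt_crossing {p q : ℝ × ℝ} {x : ℝ} (h : p.1 < q.1)
    (hx : q.1 * x + q.2 < p.1 * x + p.2) : x < crossing p q := by
  have h1 := height_crossing h.ne
  by_contra! hc
  nlinarith

/-- The height at which the lines `p` and `q` cross. -/
noncomputable def crossingHeight (p q : ℝ × ℝ) : ℝ := p.1 * crossing p q + p.2

/-- The intercept that a line of slope `r.1` needs in order to pass through the crossing of the
lines `p` and `q`. Dually, this is the value at `r.1` of the affine function through the points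
`p` and `q`. -/
noncomputable def interceptThrough (p q r : ℝ × ℝ) : ℝ :=
  p.2 + crossing p q * (p.1 - r.1)

/-! ### The network formed by generic lines -/

theorem crossing_eq_of_pair_eq {n : ℕ} (ℓ : Fin n → ℝ × ℝ) {i j i' j' : Fin n}
    (h : ({i, j} : Finset (Fin n)) = {i', j'}) :
    crossing (ℓ i) (ℓ j) = crossing (ℓ i') (ℓ j') := by
  rw [← Finset.coe_inj] at h
  push_cast at h
  rcases Set.pair_eq_pair_iff.1 h with ⟨rfl, rfl⟩ | ⟨rfl, rfl⟩
  · rfl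
  · exact crossing_comm _ _

theorem CMSN.exists_pair {n L : ℕ} (N : CMSN n L) (k : Fin L) :
    ∃ i j, i ≠ j ∧ N.packet k = {i, j} :=
  Finset.card_eq_two.1 (N.card_packet k)

namespace RCMSN

variable {n : ℕ} (N : RCMSN n)

theorem image_packet : Finset.univ.image N.packet = Finset.powersetCard 2 Finset.univ := by
  refine Finset.eq_of_subset_of_card_le ?_ ?_
  · intro s hs
    obtain ⟨k, -, rfl⟩ := Finset.mem_image.1 hs
    exact Finset.mem_powersetCard.2 ⟨Finset.subset_univ _, N.card_packet k⟩
  · rw [Finset.card_image_of_injective _ N.packet_injective]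
    simp

theorem exists_packet_eq {i j : Fin n} (h : i ≠ j) : ∃ k, N.packet k = {i, j} := by
  have : ({i, j} : Finset (Fin n)) ∈ Finset.univ.image N.packet := by
    rw [N.image_packet]
    simp [Finset.mem_powersetCard, Finset.card_pair h]
  simpa using this

instance : Finite (RCMSN n) :=
  Finite.of_injective (fun N : RCMSN n => N.packet) fun N N' h => by
    ext1
    exact h

open Classical in
/-- Summing over the packets amounts to summing over the ordered pairs of distinct sensors, where
every packet is counted twice. -/
theorem two_mul_sum_packet (f : Finset (Fin n) → ℝ) :
    2 * ∑ k, f (N.packet k) = ∑ p ∈ (Finset.univ : Finset (Fin n)).offDiag, f {p.1, p.2} := by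
  have h1 : ∑ k, f (N.packet k) = ∑ s ∈ Finset.powersetCard 2 Finset.univ, f s := by
    rw [← N.image_packet, Finset.sum_image N.packet_injective.injOn]
  rw [h1, Finset.mul_sum, ← Finset.sum_fiberwise_of_maps_to
    (t := Finset.powersetCard 2 (Finset.univ : Finset (Fin n)))
    (g := fun p : Fin n × Fin n => ({p.1, p.2} : Finset (Fin n)))]
  · refine Finset.sum_congr rfl fun s hs => ?_
    obtain ⟨i, j, hij, rfl⟩ := Finset.card_eq_two.1 (Finset.mem_powersetCard.1 hs).2
    have : Finset.univ.offDiag.filter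
        (fun p : Fin n × Fin n => ({p.1, p.2} : Finset (Fin n)) = {i, j}) = {(i, j), (j, i)} := by
      ext ⟨a, b⟩
      rw [Finset.mem_filter, ← Finset.coe_inj]
      push_cast
      rw [Set.pair_eq_pair_iff]
      simp only [Finset.mem_offDiag, Finset.mem_univ, true_and, Finset.mem_insert, Prod.mk.injEq,
        Finset.mem_singleton, ne_eq]
      constructor
      · exact fun h => h.2
      · rintro (⟨rfl, rfl⟩ | ⟨rfl, rfl⟩)
        · exact ⟨hij, by simp⟩
        · exact ⟨hij.symm, by simp⟩
    rw [this, Finset.sum_pair (by simp [hij])]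
    rw [Finset.pair_comm j i]
    ring
  · rintro ⟨i, j⟩ hp
    have : i ≠ j := by simpa using hp
    simp [Finset.mem_powersetCard, Finset.card_pair this]

end RCMSN

/-- The two genericity conditions under which lines form a network. -/
structure IsGenericLines {n : ℕ} (ℓ : Fin n → ℝ × ℝ) : Prop where
  slope_injective : Function.Injective fun i => (ℓ i).1
  crossing_injective : ∀ i j i' j' : Fin n, i ≠ j → i' ≠ j' →
    crossing (ℓ i) (ℓ j) = crossing (ℓ i') (ℓ j') → ({i, j} : Finset (Fin n)) = {i', j'}

open Classical in
/-- The crossing of the two lines in a two-element set of indices; `0` for other sets. -/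
noncomputable def pairCrossing {n : ℕ} (ℓ : Fin n → ℝ × ℝ) (s : Finset (Fin n)) : ℝ :=
  if h : ∃ p : Fin n × Fin n, s = {p.1, p.2} then crossing (ℓ h.choose.1) (ℓ h.choose.2) else 0

theorem pairCrossing_pair {n : ℕ} (ℓ : Fin n → ℝ × ℝ) (i j : Fin n) :
    pairCrossing ℓ {i, j} = crossing (ℓ i) (ℓ j) := by
  have h : ∃ p : Fin n × Fin n, ({i, j} : Finset (Fin n)) = {p.1, p.2} := ⟨(i, j), rfl⟩
  rw [pairCrossing, dif_pos h]
  exact (crossing_eq_of_pair_eq ℓ h.choose_spec).symm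

theorem IsGenericLines.pairCrossing_injOn {n : ℕ} {ℓ : Fin n → ℝ × ℝ} (h : IsGenericLines ℓ) :
    Set.InjOn (pairCrossing ℓ) (Finset.powersetCard 2 (Finset.univ : Finset (Fin n))) := by
  intro s hs t ht hst
  obtain ⟨i, j, hij, rfl⟩ := Finset.card_eq_two.1 (Finset.mem_powersetCard.1 hs).2
  obtain ⟨i', j', hij', rfl⟩ := Finset.card_eq_two.1 (Finset.mem_powersetCard.1 ht).2
  rw [pairCrossing_pair, pairCrossing_pair] at hst
  exact h.crossing_injective _ _ _ _ hij hij' hst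

/-- The finite set of all crossings. -/
noncomputable def crossings {n : ℕ} (ℓ : Fin n → ℝ × ℝ) : Finset ℝ :=
  (Finset.powersetCard 2 Finset.univ).image (pairCrossing ℓ)

theorem IsGenericLines.card_crossings {n : ℕ} {ℓ : Fin n → ℝ × ℝ} (h : IsGenericLines ℓ) :
    (crossings ℓ).card = n.choose 2 := by
  rw [crossings, Finset.card_image_of_injOn h.pairCrossing_injOn]
  simp

theorem isGMSN_iff {n : ℕ} {ℓ : Fin n → ℝ × ℝ} {N : RCMSN n} :
    IsGMSN ℓ N ↔ IsGenericLines ℓ ∧ StrictMono fun k => pairCrossing ℓ (N.packet k) := by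
  constructor
  · intro h
    refine ⟨⟨h.1, h.2⟩, fun s t hst => ?_⟩
    obtain ⟨i, j, -, hs⟩ := N.exists_pair s
    obtain ⟨i', j', -, ht⟩ := N.exists_pair t
    simp only [hs, ht, pairCrossing_pair]
    exact h.sorted s t hst _ _ _ _ hs ht
  · rintro ⟨h, hm⟩
    refine ⟨h.1, h.2, fun s t hst i j i' j' hs ht => ?_⟩
    simpa only [hs, ht, pairCrossing_pair] using hm hst

theorem IsGenericLines.existsUnique {n : ℕ} {ℓ : Fin n → ℝ × ℝ} (h : IsGenericLines ℓ) :
    ∃! N : RCMSN n, IsGMSN ℓ N := by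
  have hmem : ∀ k, ∃ s ∈ Finset.powersetCard 2 (Finset.univ : Finset (Fin n)),
      pairCrossing ℓ s = (crossings ℓ).orderEmbOfFin h.card_crossings k := fun k =>
    Finset.mem_image.1 (Finset.orderEmbOfFin_mem _ h.card_crossings k)
  choose f hf hfc using hmem
  refine ⟨⟨⟨f, fun k => (Finset.mem_powersetCard.1 (hf k)).2⟩, fun k k' hk => ?_⟩, ?_, ?_⟩
  · have hk' : f k = f k' := hk
    have := hfc k
    rw [hk', hfc k'] at this
    exact ((crossings ℓ).orderEmbOfFin h.card_crossings).injective this.symm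
  · refine isGMSN_iff.2 ⟨h, fun k k' hk => ?_⟩
    simp only [hfc]
    exact ((crossings ℓ).orderEmbOfFin h.card_crossings).strictMono hk
  · intro N hN
    have hmono := (isGMSN_iff.1 hN).2
    have hN2 : ∀ k, N.packet k ∈ Finset.powersetCard 2 (Finset.univ : Finset (Fin n)) := fun k =>
      Finset.mem_powersetCard.2 ⟨Finset.subset_univ _, N.card_packet k⟩
    have key := Finset.orderEmbOfFin_unique h.card_crossings
      (fun k => Finset.mem_image_of_mem (pairCrossing ℓ) (hN2 k)) hmono
    ext1
    funext k
    refine h.pairCrossing_injOn (hN2 k) (hf k) ?_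
    rw [hfc k]
    exact congrFun key k

theorem IsGMSN.unique {n : ℕ} {ℓ : Fin n → ℝ × ℝ} {N N' : RCMSN n} (h : IsGMSN ℓ N)
    (h' : IsGMSN ℓ N') : N = N' :=
  (isGMSN_iff.1 h).1.existsUnique.unique h h'

theorem IsGMSN.gmsnCapacity_eq {n : ℕ} {ℓ : Fin n → ℝ × ℝ} {N : RCMSN n} (h : IsGMSN ℓ N) :
    gmsnCapacity ℓ = N.capacity := by
  have h' : ∃ N : RCMSN n, IsGMSN ℓ N := ⟨N, h⟩
  rw [gmsnCapacity, dif_pos h', h'.choose_spec.unique h]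

/-! ### Which sensors are reached -/

section Reach

variable {n : ℕ} {ℓ : Fin n → ℝ × ℝ} {N : RCMSN n}

theorem IsGMSN.lt_iff_crossing_lt (h : IsGMSN ℓ N) {s t : Fin (n.choose 2)} {i j i' j' : Fin n}
    (hs : N.packet s = {i, j}) (ht : N.packet t = {i', j'}) :
    s < t ↔ crossing (ℓ i) (ℓ j) < crossing (ℓ i') (ℓ j') := by
  have := (isGMSN_iff.1 h).2.lt_iff_lt (a := s) (b := t)
  simpa only [hs, ht, pairCrossing_pair] using this.symm

theorem IsGMSN.slope_ne (h : IsGMSN ℓ N) {i j : Fin n} (hij : i ≠ j) : (ℓ i).1 ≠ (ℓ j).1 :=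
  fun e => hij (h.slope_injective e)

theorem CMSN.CanReach.of_mem {n L : ℕ} {N : CMSN n L} {k : Fin L} {x : Fin n}
    (hx : x ∈ N.packet k) : N.CanReach k x :=
  ⟨0, fun _ => k, rfl, fun i j hij => absurd hij (by omega),
    fun j => j.elim0, hx⟩

theorem CMSN.CanReach.cons {n L : ℕ} {N : CMSN n L} {k k' : Fin L} {x : Fin n} (hk : k < k')
    (hi : (N.packet k' ∩ N.packet k).Nonempty) (h : N.CanReach k' x) : N.CanReach k x := by
  obtain ⟨m, c, h0, hm, hc, hx⟩ := h
  refine ⟨m + 1, Fin.cons k c, rfl, ?_, ?_, ?_⟩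
  · refine Fin.strictMono_iff_lt_succ.2 fun j => ?_
    refine Fin.cases ?_ (fun j => ?_) j
    · simpa [h0] using hk
    · rw [← Fin.succ_castSucc]
      simpa using hm (Fin.castSucc_lt_succ (i := j))
  · intro j
    refine Fin.cases ?_ (fun j => ?_) j
    · simpa [h0] using hi
    · rw [← Fin.succ_castSucc]
      simpa using hc j
  · rw [← Fin.succ_last]
    simpa using hx

/-- Messages created at a crossing to the right of the `y`-axis stay below a certain line. For
`s = 1` and `y₀` the height of the crossing `x₀`, this is the line through `(x₀, y₀)` with intercept
`c`; all sensors that receive the message have larger intercepts, so that their slopes are smaller.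
For `s = -1` the same happens upside down. -/
theorem IsGMSN.lt_interceptThrough_of_canReach (h : IsGMSN ℓ N) {s c : ℝ}
    (hc : ∀ w, c < s * (ℓ w).2) {i j x : Fin n} (hij : i ≠ j) (h0 : 0 < crossing (ℓ i) (ℓ j))
    {k : Fin (n.choose 2)} (hk : N.packet k = {i, j}) (hx : N.CanReach k x) :
    c < s * interceptThrough (ℓ i) (ℓ j) (ℓ x) := by
  obtain ⟨m, d, rfl, hd, hi, hxm⟩ := hx
  set x₀ := crossing (ℓ i) (ℓ j) with hx₀
  set β := (s * ((ℓ i).1 * x₀ + (ℓ i).2) - c) / x₀ with hβ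
  have hβx : β * x₀ = s * ((ℓ i).1 * x₀ + (ℓ i).2) - c := by
    rw [hβ]; field_simp
  -- a line meeting the region below the bounding line, to the right of the axis, is less steep
  have slope : ∀ w X, x₀ ≤ X → s * ((ℓ w).1 * X + (ℓ w).2) ≤ β * X + c → s * (ℓ w).1 < β := by
    intro w X hX hw
    have hw' := hc w
    by_contra! hcon
    nlinarith
  have key : ∀ r : Fin (m + 1), ∀ u v, u ≠ v → N.packet (d r) = {u, v} →
      x₀ ≤ crossing (ℓ u) (ℓ v) ∧
      s * ((ℓ u).1 * crossing (ℓ u) (ℓ v) + (ℓ u).2) ≤ β * crossing (ℓ u) (ℓ v) + c := by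
    intro r
    induction r using Fin.induction with
    | zero =>
      intro u v huv hp
      rw [hk] at hp
      have e := crossing_eq_of_pair_eq ℓ hp
      rw [← e]
      refine ⟨le_rfl, le_of_eq ?_⟩
      have hu : u = i ∨ u = j := by
        have : u ∈ ({i, j} : Finset (Fin n)) := by rw [hp]; simp
        simpa using this
      rw [← hx₀, hβx]
      rcases hu with rfl | rfl
      · ring
      · have := height_crossing (h.slope_ne hij)
        rw [← hx₀] at this
        rw [this]; ring
    | succ r ih =>
      -- it suffices to follow the line of the sensor shared with the previous packet
      have main : ∀ u v, u ≠ v → N.packet (d r.succ) = {u, v} → u ∈ N.packet (d r.castSucc) →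
          x₀ ≤ crossing (ℓ u) (ℓ v) ∧
          s * ((ℓ u).1 * crossing (ℓ u) (ℓ v) + (ℓ u).2) ≤ β * crossing (ℓ u) (ℓ v) + c := by
        intro u v huv hp hu
        obtain ⟨w, hwu, hw⟩ : ∃ w, w ≠ u ∧ N.packet (d r.castSucc) = {u, w} := by
          obtain ⟨a, b, hab, hp'⟩ := N.exists_pair (d r.castSucc)
          have : u = a ∨ u = b := by
            have := hu
            rw [hp'] at this
            simpa using this
          rcases this with rfl | rfl
          · exact ⟨b, hab.symm, hp'⟩
          · exact ⟨a, hab, by rw [hp', Finset.pair_comm]⟩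
        obtain ⟨h1, h2⟩ := ih u w hwu.symm hw
        have h3 := (h.lt_iff_crossing_lt hw hp).1 (hd (Fin.castSucc_lt_succ (i := r)))
        have h4 := slope u _ h1 h2
        refine ⟨h1.trans h3.le, ?_⟩
        nlinarith
      intro u v huv hp
      obtain ⟨w, hw⟩ := hi r
      rw [Finset.mem_inter] at hw
      have : w = u ∨ w = v := by
        have := hw.1
        rw [hp] at this
        simpa using this
      rcases this with rfl | rfl
      · exact main w v huv hp hw.2
      · have := main w u huv.symm (by rw [hp, Finset.pair_comm]) hw.2
        rwa [height_crossing (h.slope_ne huv).symm, crossing_comm (ℓ w)] at this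
  obtain ⟨a, b, hab, hp⟩ := N.exists_pair (d (Fin.last m))
  obtain ⟨h1, h2⟩ := key _ a b hab hp
  have hxs : s * (ℓ x).1 < β := by
    have : x = a ∨ x = b := by
      rw [hp] at hxm
      simpa using hxm
    rcases this with rfl | rfl
    · exact slope _ _ h1 h2
    · rw [height_crossing (h.slope_ne hab)] at h2
      exact slope _ _ h1 h2
  unfold interceptThrough
  rw [← hx₀]
  nlinarith

/-- A line that passes above the crossing of `i` and `j` and is less steep than line `i` meets that
line later on; the factor `s = -1` turns the picture upside down. -/
theorem IsGMSN.canReach_direct (h : IsGMSN ℓ N) {s : ℝ} (hs : s = 1 ∨ s = -1) {i j x : Fin n}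
    {k : Fin (n.choose 2)} (hk : N.packet k = {i, j})
    (hx : s * crossingHeight (ℓ i) (ℓ j) <
      s * ((ℓ x).1 * crossing (ℓ i) (ℓ j) + (ℓ x).2))
    (hxi : s * (ℓ x).1 < s * (ℓ i).1) : N.CanReach k x := by
  have hne : x ≠ i := by rintro rfl; exact lt_irrefl _ hxi
  obtain ⟨k', hk'⟩ := N.exists_packet_eq hne
  refine CMSN.CanReach.cons (k' := k') ?_ ⟨i, by simp [hk, hk']⟩ (.of_mem (by simp [hk']))
  rw [h.lt_iff_crossing_lt hk hk']
  unfold crossingHeight at hx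
  rcases hs with rfl | rfl
  · exact lt_crossing (by linarith) (by linarith)
  · rw [crossing_comm (ℓ x)]
    exact lt_crossing (by linarith) (by linarith)

/-- A line that passes above the crossing of `i` and `j` and is steeper than line `i` is reached
through any still steeper line `w` passing below that crossing: line `w` first meets line `i`, then
line `x`. The factor `s = -1` turns the picture upside down. -/
theorem IsGMSN.canReach_relay (h : IsGMSN ℓ N) {s : ℝ} (hs : s = 1 ∨ s = -1) {i j x w : Fin n}
    {k : Fin (n.choose 2)} (hk : N.packet k = {i, j})
    (hx : s * crossingHeight (ℓ i) (ℓ j) <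
      s * ((ℓ x).1 * crossing (ℓ i) (ℓ j) + (ℓ x).2))
    (hxi : s * (ℓ i).1 < s * (ℓ x).1) (hwx : s * (ℓ x).1 < s * (ℓ w).1)
    (hw : s * ((ℓ w).1 * crossing (ℓ i) (ℓ j) + (ℓ w).2) < s * crossingHeight (ℓ i) (ℓ j)) :
    N.CanReach k x := by
  have hiw : i ≠ w := by rintro rfl; exact lt_irrefl _ (hxi.trans hwx)
  have hne : x ≠ w := by rintro rfl; exact lt_irrefl _ hwx
  obtain ⟨k', hk'⟩ := N.exists_packet_eq hiw
  obtain ⟨k'', hk''⟩ := N.exists_packet_eq hne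
  have h1 : crossing (ℓ i) (ℓ j) < crossing (ℓ i) (ℓ w) := by
    unfold crossingHeight at hx hw
    rcases hs with rfl | rfl
    · exact lt_crossing (by linarith) (by linarith)
    · rw [crossing_comm (ℓ i) (ℓ w)]
      exact lt_crossing (by linarith) (by linarith)
  have h2 : crossing (ℓ i) (ℓ w) < crossing (ℓ x) (ℓ w) := by
    have e := height_crossing (h.slope_ne hiw)
    unfold crossingHeight at hx hw
    rcases hs with rfl | rfl
    · exact lt_crossing (by linarith) (by nlinarith)
    · rw [crossing_comm (ℓ x) (ℓ w)]
      exact lt_crossing (by linarith) (by nlinarith)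
  refine CMSN.CanReach.cons (k' := k') ?_ ⟨i, by simp [hk, hk']⟩
    (CMSN.CanReach.cons (k' := k'') ?_ ⟨w, by simp [hk', hk'']⟩ (.of_mem (by simp [hk''])))
  · rwa [h.lt_iff_crossing_lt hk hk']
  · rwa [h.lt_iff_crossing_lt hk' hk'']

end Reach

/-! ### The uniform distribution on a rectangle -/

/-- The uniform distribution on the interval `[a, b]`. -/
noncomputable def uniformIcc (a b : ℝ) : Measure ℝ := ProbabilityTheory.cond volume (Set.Icc a b)

/-- The uniform distribution on the rectangle `[a, b] × [c, d]`. -/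
noncomputable def uniformBox (a b c d : ℝ) : Measure (ℝ × ℝ) :=
  (uniformIcc a b).prod (uniformIcc c d)

theorem isProbabilityMeasure_uniformIcc {a b : ℝ} (h : a < b) :
    IsProbabilityMeasure (uniformIcc a b) :=
  cond_isProbabilityMeasure_of_finite (by simp [h]) (by simp)

instance (a b : ℝ) : IsFiniteMeasure (uniformIcc a b) := by
  unfold uniformIcc; infer_instance

instance (a b : ℝ) : NullSingletonClass (uniformIcc a b) :=
  ⟨fun x => cond_absolutelyContinuous (measure_singleton x)⟩

instance (a b c d : ℝ) : IsFiniteMeasure (uniformBox a b c d) := by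
  unfold uniformBox; infer_instance

theorem isProbabilityMeasure_uniformBox {a b c d : ℝ} (h : a < b) (h' : c < d) :
    IsProbabilityMeasure (uniformBox a b c d) := by
  have := isProbabilityMeasure_uniformIcc h
  have := isProbabilityMeasure_uniformIcc h'
  unfold uniformBox; infer_instance

theorem cond_volume_prod_Icc {a b c d : ℝ} (h : a < b) (h' : c < d) :
    ProbabilityTheory.cond volume (Set.Icc a b ×ˢ Set.Icc c d) = uniformBox a b c d := by
  unfold uniformBox uniformIcc ProbabilityTheory.cond
  rw [Measure.prod_smul_left, Measure.prod_smul_right, Measure.prod_restrict, smul_smul,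
    Measure.volume_eq_prod, Measure.prod_prod, ENNReal.mul_inv (by simp [h]) (by simp [h'])]

theorem uniformIcc_apply (a b : ℝ) (s : Set ℝ) :
    uniformIcc a b s = (ENNReal.ofReal (b - a))⁻¹ * volume (Set.Icc a b ∩ s) := by
  rw [uniformIcc, cond_apply measurableSet_Icc, Real.volume_Icc]

theorem uniformIcc_Ioo {a b c d : ℝ} (h : a < b) (hc : a ≤ c) (hd : d ≤ b) :
    uniformIcc a b (Set.Ioo c d) = ENNReal.ofReal ((d - c) / (b - a)) := by
  have : Set.Icc a b ∩ Set.Ioo c d = Set.Ioo c d :=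
    Set.inter_eq_right.2 (Set.Ioo_subset_Icc_self.trans (Set.Icc_subset_Icc hc hd))
  rw [uniformIcc_apply, this, Real.volume_Ioo, mul_comm, ← div_eq_mul_inv,
    ENNReal.ofReal_div_of_pos (by linarith)]

theorem ae_mem_Ioo_uniformIcc (a b : ℝ) : ∀ᵐ x ∂(uniformIcc a b), x ∈ Set.Ioo a b := by
  unfold uniformIcc ProbabilityTheory.cond
  refine Measure.ae_smul_measure ?_ _
  rw [← restrict_Ioo_eq_restrict_Icc]
  exact ae_restrict_mem measurableSet_Ioo

theorem ae_mem_box {a b c d : ℝ} :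
    ∀ᵐ p ∂(uniformBox a b c d), p.1 ∈ Set.Ioo a b ∧ p.2 ∈ Set.Ioo c d := by
  unfold uniformBox
  filter_upwards [Measure.quasiMeasurePreserving_fst.ae (ae_mem_Ioo_uniformIcc a b),
    Measure.quasiMeasurePreserving_snd.ae (ae_mem_Ioo_uniformIcc c d)] with p h1 h2
  exact ⟨h1, h2⟩

theorem uniformBox_pos_of_isOpen {a b c d : ℝ} {O : Set (ℝ × ℝ)} (hO : IsOpen O) {w : ℝ × ℝ}
    (hw : w ∈ O) (h1 : w.1 ∈ Set.Ioo a b) (h2 : w.2 ∈ Set.Ioo c d) :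
    0 < uniformBox a b c d O := by
  have ha : a < b := h1.1.trans h1.2
  have hc : c < d := h2.1.trans h2.2
  rw [← cond_volume_prod_Icc ha hc, cond_apply (measurableSet_Icc.prod measurableSet_Icc)]
  refine ENNReal.mul_pos ?_ ?_
  · refine ENNReal.inv_ne_zero.2 ?_
    rw [Measure.volume_eq_prod, Measure.prod_prod]
    simp [ENNReal.mul_eq_top]
  · refine ne_of_gt (lt_of_lt_of_le ?_ (measure_mono
      (s := (Set.Ioo a b ×ˢ Set.Ioo c d) ∩ O) ?_))
    · exact ((isOpen_Ioo.prod isOpen_Ioo).inter hO).measure_pos _ ⟨w, ⟨h1, h2⟩, hw⟩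
    · exact Set.inter_subset_inter_left _
        (Set.prod_mono Set.Ioo_subset_Icc_self Set.Ioo_subset_Icc_self)

/-- The mirror image of the uniform distribution is the uniform distribution. -/
theorem measurePreserving_reflect (a b : ℝ) :
    MeasurePreserving (fun x => a + b - x) (uniformIcc a b) (uniformIcc a b) := by
  have hm : Measurable fun x : ℝ => a + b - x := by fun_prop
  refine ⟨hm, ?_⟩
  ext s hs
  rw [Measure.map_apply hm hs, uniformIcc_apply, uniformIcc_apply]
  congr 1
  have hp : MeasurePreserving (fun x : ℝ => a + b - x) volume volume :=
    Measure.measurePreserving_sub_left volume (a + b)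
  rw [← hp.measure_preimage (measurableSet_Icc.inter hs).nullMeasurableSet]
  congr 1
  ext x
  simp only [Set.mem_inter_iff, Set.mem_Icc, Set.mem_preimage]
  constructor <;> rintro ⟨⟨h1, h2⟩, h3⟩ <;> exact ⟨⟨by linarith, by linarith⟩, h3⟩

theorem measure_fst_eq_zero {ν κ : Measure ℝ} [SFinite ν] [SFinite κ] [NullSingletonClass ν] (c : ℝ) :
    (ν.prod κ) {p | p.1 = c} = 0 := by
  have : {p : ℝ × ℝ | p.1 = c} = {c} ×ˢ Set.univ := by ext; simp
  rw [this, Measure.prod_prod]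
  simp

theorem measure_line_eq_zero {ν κ : Measure ℝ} [SFinite ν] [SFinite κ] [NullSingletonClass κ] (c d : ℝ) :
    (ν.prod κ) {p | p.1 * c + p.2 = d} = 0 := by
  rw [Measure.measure_prod_null (measurableSet_eq_fun (by fun_prop) (by fun_prop))]
  refine ae_of_all _ fun x => ?_
  change κ (Prod.mk x ⁻¹' {p : ℝ × ℝ | p.1 * c + p.2 = d}) = 0
  have : (Prod.mk x ⁻¹' {p : ℝ × ℝ | p.1 * c + p.2 = d}) = {d - x * c} := by
    ext y
    simp only [Set.mem_preimage, Set.mem_ofPred_eq, Set.mem_singleton_iff]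
    constructor <;> intro h <;> linarith
  rw [this]
  simp

theorem measure_crossing_eq_zero {ν κ : Measure ℝ} [SFinite ν] [SFinite κ] [NullSingletonClass ν]
    [NullSingletonClass κ] (p : ℝ × ℝ) (c : ℝ) : (ν.prod κ) {q | crossing p q = c} = 0 := by
  refine measure_mono_null (t := {q | q.1 = p.1} ∪ {q | q.1 * c + q.2 = p.1 * c + p.2}) ?_
    (measure_union_null (measure_fst_eq_zero _) (measure_line_eq_zero _ _))
  intro q hq
  by_cases h : q.1 = p.1
  · exact Or.inl h
  · exact Or.inr ((crossing_eq_iff (Ne.symm h) c).1 hq).symm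

/-! ### Three random lines: the probability of the unreachable configuration -/

@[fun_prop]
theorem measurable_crossing : Measurable fun p : (ℝ × ℝ) × (ℝ × ℝ) => crossing p.1 p.2 := by
  unfold crossing; fun_prop

theorem measurable_interceptThrough :
    Measurable fun t : ((ℝ × ℝ) × (ℝ × ℝ)) × (ℝ × ℝ) => interceptThrough t.1.1 t.1.2 t.2 := by
  unfold interceptThrough crossing; fun_prop

/-- The triples `((p, q), r)` of lines such that a message created at the crossing of `p` and `q`
never arrives at `r`, whatever the other lines with intercepts in `(c, d)` are: the crossing is to
the right of the `y`-axis, and no line with the slope of `r` through it has its intercept in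
`(c, d)`. -/
def unreachable (c d : ℝ) : Set (((ℝ × ℝ) × (ℝ × ℝ)) × (ℝ × ℝ)) :=
  {t | 0 < crossing t.1.1 t.1.2 ∧ interceptThrough t.1.1 t.1.2 t.2 ∉ Set.Ioo c d}

theorem measurableSet_unreachable (c d : ℝ) : MeasurableSet (unreachable c d) :=
  (measurableSet_lt measurable_const (measurable_crossing.comp measurable_fst)).inter
    (measurable_interceptThrough measurableSet_Ioo).compl

theorem preimage_extrapolate {c d t x : ℝ} (ht : 1 < t) :
    {y | x + t * (y - x) ∈ Set.Ioo c d} = Set.Ioo (x + (c - x) / t) (x + (d - x) / t) := by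
  have ht0 : 0 < t := by linarith
  ext y
  simp only [Set.mem_ofPred_eq, Set.mem_Ioo]
  refine and_congr ?_ ?_
  · rw [← lt_sub_iff_add_lt', div_lt_iff₀ ht0]
    constructor <;> intro <;> linarith
  · rw [← sub_lt_iff_lt_add', lt_div_iff₀ ht0]
    constructor <;> intro <;> linarith

theorem measurableSet_extrapolate (c d t : ℝ) :
    MeasurableSet {p : ℝ × ℝ | p.1 + t * (p.2 - p.1) ∈ Set.Ioo c d} :=
  (by fun_prop : Measurable fun p : ℝ × ℝ => p.1 + t * (p.2 - p.1)) measurableSet_Ioo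

theorem uniform_extrapolate_of_one_lt {c d t : ℝ} (h : c < d) (ht : 1 < t) :
    ((uniformIcc c d).prod (uniformIcc c d)) {p | p.1 + t * (p.2 - p.1) ∈ Set.Ioo c d} =
      ENNReal.ofReal (1 / t) := by
  have := isProbabilityMeasure_uniformIcc h
  rw [Measure.prod_apply (measurableSet_extrapolate c d t)]
  have : ∀ᵐ x ∂(uniformIcc c d), uniformIcc c d
      (Prod.mk x ⁻¹' {p : ℝ × ℝ | p.1 + t * (p.2 - p.1) ∈ Set.Ioo c d}) =
      ENNReal.ofReal (1 / t) := by
    filter_upwards [ae_mem_Ioo_uniformIcc c d] with x hx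
    have ht0 : 0 < t := by linarith
    -- the admissible end points form an interval shrunk by `t` towards `x`
    have e := preimage_extrapolate (c := c) (d := d) (x := x) ht
    have e1 : (Prod.mk x ⁻¹' {p : ℝ × ℝ | p.1 + t * (p.2 - p.1) ∈ Set.Ioo c d}) =
      {y | x + t * (y - x) ∈ Set.Ioo c d} := rfl
    rw [e1, e, uniformIcc_Ioo h]
    · congr 1
      have : d - c ≠ 0 := by linarith
      field_simp
      ring
    · have : (x - c) / t ≤ x - c := div_le_self (by linarith [hx.1]) ht.le
      have e2 : (c - x) / t = - ((x - c) / t) := by ring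
      linarith
    · have : (d - x) / t ≤ d - x := div_le_self (by linarith [hx.2]) ht.le
      linarith
  rw [lintegral_congr_ae this]
  simp

/-- The value at `t` of the affine function with independent uniform values at `0` and `1` is in
the range of these values with probability one over the length of the hull of `0`, `1`, `t`. -/
theorem uniform_extrapolate {c d : ℝ} (h : c < d) (t : ℝ) :
    ((uniformIcc c d).prod (uniformIcc c d)) {p | p.1 + t * (p.2 - p.1) ∈ Set.Ioo c d} =
      ENNReal.ofReal (1 / max 1 (max |t| |1 - t|)) := by
  have := isProbabilityMeasure_uniformIcc h
  rcases lt_or_ge 1 t with ht | ht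
  · rw [uniform_extrapolate_of_one_lt h ht]
    congr 2
    rw [abs_of_pos (a := t) (by linarith), abs_of_neg (a := 1 - t) (by linarith),
      max_eq_left (a := t) (by linarith), max_eq_right ht.le]
  rcases lt_or_ge t 0 with ht0 | ht0
  · rw [← (Measure.measurePreserving_swap (μ := uniformIcc c d)
      (ν := uniformIcc c d)).measure_preimage (measurableSet_extrapolate c d t).nullMeasurableSet]
    have : Prod.swap ⁻¹' {p : ℝ × ℝ | p.1 + t * (p.2 - p.1) ∈ Set.Ioo c d} =
        {p | p.1 + (1 - t) * (p.2 - p.1) ∈ Set.Ioo c d} := by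
      ext p
      simp only [Set.mem_preimage, Set.mem_ofPred_eq, Prod.fst_swap, Prod.snd_swap]
      rw [show p.2 + t * (p.1 - p.2) = p.1 + (1 - t) * (p.2 - p.1) by ring]
    rw [this, uniform_extrapolate_of_one_lt h (by linarith)]
    congr 2
    rw [abs_of_neg ht0, abs_of_pos (a := 1 - t) (by linarith),
      max_eq_right (a := -t) (by linarith), max_eq_right (by linarith)]
  · have e : max 1 (max |t| |1 - t|) = 1 := by
      rw [abs_of_nonneg ht0, abs_of_nonneg (by linarith)]
      exact max_eq_left (max_le ht (by linarith))
    rw [e]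
    simp only [div_one, ENNReal.ofReal_one]
    rw [← prob_compl_eq_zero_iff (measurableSet_extrapolate c d t), ← mem_ae_iff]
    have := ae_mem_box (a := c) (b := d) (c := c) (d := d)
    unfold uniformBox at this
    filter_upwards [this] with p hp
    have hconv := (convex_Ioo c d) hp.1 hp.2 (by linarith : 0 ≤ 1 - t) ht0 (by ring)
    simp only [smul_eq_mul] at hconv
    rwa [show p.1 + t * (p.2 - p.1) = (1 - t) * p.1 + t * p.2 by ring]

/-- The distance of the first two of three reals relative to the length of their hull. -/
noncomputable def relDist (x y z : ℝ) : ℝ := |x - y| / max |x - y| (max |x - z| |y - z|)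

theorem relDist_nonneg (x y z : ℝ) : 0 ≤ relDist x y z := by
  unfold relDist; positivity

theorem relDist_sum {x y z : ℝ} (h : x ≠ y) :
    relDist x y z + relDist x z y + relDist y z x = 2 := by
  have hpos : 0 < max |x - y| (max |x - z| |y - z|) :=
    lt_max_of_lt_left (abs_pos.2 (sub_ne_zero.2 h))
  have e1 : max |x - z| (max |x - y| |z - y|) = max |x - y| (max |x - z| |y - z|) := by
    rw [abs_sub_comm z y]; exact max_left_comm _ _ _
  have e2 : max |y - z| (max |y - x| |z - x|) = max |x - y| (max |x - z| |y - z|) := by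
    rw [abs_sub_comm z x, abs_sub_comm y x, max_left_comm, max_comm |y - z|]
  have key : |x - y| + |x - z| + |y - z| = 2 * max |x - y| (max |x - z| |y - z|) := by
    rcases max_cases |x - y| (max |x - z| |y - z|) with h1 | h1 <;>
    rcases max_cases |x - z| |y - z| with h2 | h2 <;>
    rcases abs_cases (x - y) with h3 | h3 <;> rcases abs_cases (x - z) with h4 | h4 <;>
    rcases abs_cases (y - z) with h5 | h5 <;> linarith
  unfold relDist
  rw [e1, e2, ← add_div, ← add_div, key]
  field_simp

@[fun_prop]
theorem measurable_relDist {α : Type*} [MeasurableSpace α] {f g h : α → ℝ} (hf : Measurable f)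
    (hg : Measurable g) (hh : Measurable h) : Measurable fun x => relDist (f x) (g x) (h x) := by
  unfold relDist
  simp only [← Real.norm_eq_abs]
  fun_prop

section Rearrange

variable {α β γ δ : Type*} [MeasurableSpace α] [MeasurableSpace β] [MeasurableSpace γ]
  [MeasurableSpace δ] (μ₁ : Measure α) (μ₂ : Measure β) (μ₃ : Measure γ) (μ₄ : Measure δ)
  [SFinite μ₁] [SFinite μ₂] [SFinite μ₃] [SFinite μ₄]

theorem measurePreserving_swap_right :
    MeasurePreserving (fun p : (α × β) × γ => ((p.1.1, p.2), p.1.2))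
      ((μ₁.prod μ₂).prod μ₃) ((μ₁.prod μ₃).prod μ₂) :=
  ((measurePreserving_prodAssoc μ₁ μ₃ μ₂).symm _).comp
    (((MeasurePreserving.id μ₁).prod Measure.measurePreserving_swap).comp
      (measurePreserving_prodAssoc μ₁ μ₂ μ₃))

theorem measurePreserving_prodProdProdComm :
    MeasurePreserving (fun p : (α × β) × (γ × δ) => ((p.1.1, p.2.1), (p.1.2, p.2.2)))
      ((μ₁.prod μ₂).prod (μ₃.prod μ₄)) ((μ₁.prod μ₃).prod (μ₂.prod μ₄)) :=
  (measurePreserving_prodAssoc (μ₁.prod μ₃) μ₂ μ₄).comp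
    (((measurePreserving_swap_right μ₁ μ₂ μ₃).prod (MeasurePreserving.id μ₄)).comp
      ((measurePreserving_prodAssoc (μ₁.prod μ₂) μ₃ μ₄).symm _))

end Rearrange

theorem ae_fst_ne_snd (ν : Measure ℝ) [IsProbabilityMeasure ν] [NullSingletonClass ν] :
    ∀ᵐ t ∂((ν.prod ν).prod ν), t.1.1 ≠ t.1.2 := by
  refine Measure.quasiMeasurePreserving_fst.ae
    (p := fun p : ℝ × ℝ => p.1 ≠ p.2) ?_
  refine (Measure.ae_prod_iff_ae_ae (p := fun p : ℝ × ℝ => p.1 ≠ p.2)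
    (measurableSet_eq_fun measurable_fst measurable_snd).compl).2 ?_
  refine ae_of_all _ fun x => ?_
  filter_upwards [compl_mem_ae_iff.2 (measure_singleton (μ := ν) x)] with y hy
  exact fun e => hy e.symm

/-- The mean of the relative distance is `2 / 3`, since the three relative distances of three
numbers add up to `2`. -/
theorem lintegral_relDist (ν : Measure ℝ) [IsProbabilityMeasure ν] [NullSingletonClass ν] :
    ∫⁻ t, ENNReal.ofReal (relDist t.1.1 t.1.2 t.2) ∂((ν.prod ν).prod ν) = 2 / 3 := by
  set I := ∫⁻ t, ENNReal.ofReal (relDist t.1.1 t.1.2 t.2) ∂((ν.prod ν).prod ν) with hI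
  have m1 : Measurable fun t : (ℝ × ℝ) × ℝ => ENNReal.ofReal (relDist t.1.1 t.1.2 t.2) := by
    fun_prop
  have m2 : Measurable fun t : (ℝ × ℝ) × ℝ => ENNReal.ofReal (relDist t.1.1 t.2 t.1.2) := by
    fun_prop
  have m3 : Measurable fun t : (ℝ × ℝ) × ℝ => ENNReal.ofReal (relDist t.1.2 t.2 t.1.1) := by
    fun_prop
  have h2 : ∫⁻ t, ENNReal.ofReal (relDist t.1.1 t.2 t.1.2) ∂((ν.prod ν).prod ν) = I :=
    (measurePreserving_swap_right ν ν ν).lintegral_comp m1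
  have h3 : ∫⁻ t, ENNReal.ofReal (relDist t.1.2 t.2 t.1.1) ∂((ν.prod ν).prod ν) = I := by
    rw [← h2]
    exact ((Measure.measurePreserving_swap (μ := ν) (ν := ν)).prod
      (MeasurePreserving.id ν)).lintegral_comp m2
  have hne := ae_fst_ne_snd ν
  have hsum : I + I + I = 2 := by
    have e : I + I + I = ∫⁻ t, ENNReal.ofReal (relDist t.1.1 t.1.2 t.2) +
        ENNReal.ofReal (relDist t.1.1 t.2 t.1.2) +
        ENNReal.ofReal (relDist t.1.2 t.2 t.1.1) ∂((ν.prod ν).prod ν) := by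
      rw [lintegral_add_right _ m3, lintegral_add_right _ m2, h2, h3]
    rw [e, lintegral_congr_ae (g := fun _ => 2)]
    · simp
    · filter_upwards [hne] with t ht
      rw [← ENNReal.ofReal_add (relDist_nonneg _ _ _) (relDist_nonneg _ _ _),
        ← ENNReal.ofReal_add (add_nonneg (relDist_nonneg _ _ _) (relDist_nonneg _ _ _))
          (relDist_nonneg _ _ _), relDist_sum ht]
      simp
  rw [ENNReal.eq_div_iff (by simp) (by simp), ← hsum]
  ring

/-- For given slopes, this is the extrapolation problem `uniform_extrapolate`, whose answer is the
relative distance of the first two slopes. -/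
theorem interceptThrough_mem_measure {ν : Measure ℝ} [IsProbabilityMeasure ν]
    [NullSingletonClass ν] {c d : ℝ} (h : c < d) :
    (((ν.prod (uniformIcc c d)).prod (ν.prod (uniformIcc c d))).prod (ν.prod (uniformIcc c d)))
      {t | interceptThrough t.1.1 t.1.2 t.2 ∈ Set.Ioo c d} = 2 / 3 := by
  have := isProbabilityMeasure_uniformIcc h
  set κ := uniformIcc c d with hκ
  have hmp := (measurePreserving_prodProdProdComm (ν.prod ν) (κ.prod κ) ν κ).comp
    ((measurePreserving_prodProdProdComm ν κ ν κ).prod (MeasurePreserving.id (ν.prod κ)))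
  set S : Set (((ℝ × ℝ) × ℝ) × ((ℝ × ℝ) × ℝ)) :=
    {u | u.2.1.1 + (u.2.1.2 - u.2.1.1) / (u.1.1.1 - u.1.1.2) * (u.1.1.1 - u.1.2) ∈ Set.Ioo c d}
  have hS : MeasurableSet S := by
    refine measurableSet_preimage (f := fun u : ((ℝ × ℝ) × ℝ) × ((ℝ × ℝ) × ℝ) =>
      u.2.1.1 + (u.2.1.2 - u.2.1.1) / (u.1.1.1 - u.1.1.2) * (u.1.1.1 - u.1.2)) ?_ measurableSet_Ioo
    fun_prop
  have e := hmp.measure_preimage hS.nullMeasurableSet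
  refine Eq.trans (b := ((ν.prod ν).prod ν).prod ((κ.prod κ).prod κ) S) ?_ ?_
  · rw [← e]; rfl
  · rw [Measure.prod_apply hS, ← lintegral_relDist ν]
    have hne := ae_fst_ne_snd ν
    refine lintegral_congr_ae ?_
    filter_upwards [hne] with t ht
    obtain ⟨⟨x, y⟩, z⟩ := t
    have hxy : x - y ≠ 0 := sub_ne_zero.2 ht
    have hset : Prod.mk ((x, y), z) ⁻¹' S =
        {p : ℝ × ℝ | p.1 + (x - z) / (x - y) * (p.2 - p.1) ∈ Set.Ioo c d} ×ˢ Set.univ := by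
      ext ⟨⟨b₁, b₂⟩, b₃⟩
      have : (b₂ - b₁) / (x - y) * (x - z) = (x - z) / (x - y) * (b₂ - b₁) := by ring
      simp [S, this]
    rw [hset, Measure.prod_prod, measure_univ, mul_one, hκ, uniform_extrapolate h]
    congr 1
    have h1 : 1 - (x - z) / (x - y) = - ((y - z) / (x - y)) := by
      field_simp; ring
    have hp : 0 < |x - y| := abs_pos.2 hxy
    unfold relDist
    rw [h1, abs_neg, abs_div, abs_div, max_div_div_right hp.le]
    have e1 : max 1 (max |x - z| |y - z| / |x - y|) =
        max |x - y| (max |x - z| |y - z|) / |x - y| := by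
      rw [← max_div_div_right hp.le |x - y|, div_self hp.ne']
    rw [e1, one_div_div]

section Box

variable {a b c d : ℝ}

theorem measurePreserving_reflect_slopes :
    MeasurePreserving (fun p : ℝ × ℝ => (a + b - p.1, p.2)) (uniformBox a b c d)
      (uniformBox a b c d) :=
  (measurePreserving_reflect a b).prod (MeasurePreserving.id _)

theorem ae_crossing_ne (e : ℝ) :
    ∀ᵐ t ∂(((uniformBox a b c d).prod (uniformBox a b c d)).prod (uniformBox a b c d)),
      crossing t.1.1 t.1.2 ≠ e := by
  refine Measure.quasiMeasurePreserving_fst.ae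
    (p := fun p : (ℝ × ℝ) × (ℝ × ℝ) => crossing p.1 p.2 ≠ e) ?_
  refine (Measure.ae_prod_iff_ae_ae (p := fun p : (ℝ × ℝ) × (ℝ × ℝ) => crossing p.1 p.2 ≠ e)
    (measurableSet_eq_fun measurable_crossing measurable_const).compl).2 (ae_of_all _ fun p => ?_)
  exact compl_mem_ae_iff.2 (measure_crossing_eq_zero p e)

/-- Half of the probability `1 / 3` that `interceptThrough` is outside `(c, d)`: reflecting the slopes
swaps the crossings to the right and to the left of the `y`-axis. -/
theorem measure_unreachable (hab : a < b) (hcd : c < d) :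
    (((uniformBox a b c d).prod (uniformBox a b c d)).prod (uniformBox a b c d))
      (unreachable c d) = 1 / 6 := by
  have := isProbabilityMeasure_uniformIcc hab
  have := isProbabilityMeasure_uniformBox hab hcd
  set μ := uniformBox a b c d with hμ
  set Q := (μ.prod μ).prod μ with hQ
  set V := {t : ((ℝ × ℝ) × (ℝ × ℝ)) × (ℝ × ℝ) |
    interceptThrough t.1.1 t.1.2 t.2 ∈ Set.Ioo c d} with hV
  have hVm : MeasurableSet V := measurable_interceptThrough measurableSet_Ioo
  have h1 : Q Vᶜ = 1 / 3 := by
    have h2 : Q V = 2 / 3 := interceptThrough_mem_measure hcd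
    rw [prob_compl_eq_one_sub hVm, h2]
    refine ENNReal.sub_eq_of_eq_add (by simp [ENNReal.div_eq_top]) ?_
    rw [← ENNReal.add_div, show (1 + 2 : ENNReal) = 3 by norm_num,
      ENNReal.div_self (by simp) (by simp)]
  -- the mirror image of `unreachable` under the reflection of the slopes
  set U' : Set (((ℝ × ℝ) × (ℝ × ℝ)) × (ℝ × ℝ)) :=
    {t | crossing t.1.1 t.1.2 < 0 ∧ interceptThrough t.1.1 t.1.2 t.2 ∉ Set.Ioo c d} with hU'
  have hU'm : MeasurableSet U' :=
    (measurableSet_lt (measurable_crossing.comp measurable_fst) measurable_const).inter hVm.compl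
  have h2 : Q U' = Q (unreachable c d) := by
    have hρ := measurePreserving_reflect_slopes (a := a) (b := b) (c := c) (d := d)
    rw [← ((hρ.prod hρ).prod hρ).measure_preimage (measurableSet_unreachable c d).nullMeasurableSet]
    congr 1
    ext ⟨⟨p, q⟩, r⟩
    have e1 : crossing (a + b - p.1, p.2) (a + b - q.1, q.2) = - crossing p q := by
      unfold crossing
      rw [show a + b - p.1 - (a + b - q.1) = - (p.1 - q.1) by ring, div_neg]
    have e2 : interceptThrough (a + b - p.1, p.2) (a + b - q.1, q.2) (a + b - r.1, r.2) =
        interceptThrough p q r := by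
      unfold interceptThrough
      rw [e1]; ring
    simp [U', unreachable, e1, e2]
  have h3 : Q Vᶜ = Q (unreachable c d) + Q U' := by
    rw [← measure_union _ hU'm]
    · refine measure_congr ?_
      filter_upwards [ae_crossing_ne (a := a) (b := b) (c := c) (d := d) 0] with t ht
      refine propext ⟨fun h => ?_, ?_⟩
      · rcases lt_or_gt_of_ne ht with h' | h'
        · exact Or.inr ⟨h', h⟩
        · exact Or.inl ⟨h', h⟩
      · rintro (h | h)
        exacts [h.2, h.2]
    · rw [Set.disjoint_left]
      rintro t ⟨h, -⟩ ⟨h', -⟩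
      exact lt_asymm h h'
  rw [h1, h2, ← two_mul] at h3
  have h4 := (ENNReal.eq_div_iff (by simp) (by simp)).2 h3.symm
  rw [h4, ENNReal.div_eq_inv_mul, ENNReal.div_eq_inv_mul, ENNReal.div_eq_inv_mul, mul_one, mul_one,
    ← ENNReal.mul_inv (by simp) (by simp)]
  norm_num

end Box

/-! ### Relays -/

/-- The line `w` is of help for delivering a message from the crossing of `p` and `q` to `r`: either
`r` meets `p` later on anyway, or `w` meets `p` and then `r`. The two parts of the disjunction are
the cases of `r` passing above and below the crossing. -/
def IsRelay (t : ((ℝ × ℝ) × (ℝ × ℝ)) × (ℝ × ℝ)) (w : ℝ × ℝ) : Prop :=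
  (crossingHeight t.1.1 t.1.2 < t.2.1 * crossing t.1.1 t.1.2 + t.2.2 ∧
    (t.2.1 < t.1.1.1 ∨ t.1.1.1 < t.2.1 ∧ t.2.1 < w.1 ∧
      w.1 * crossing t.1.1 t.1.2 + w.2 < crossingHeight t.1.1 t.1.2)) ∨
  (t.2.1 * crossing t.1.1 t.1.2 + t.2.2 < crossingHeight t.1.1 t.1.2 ∧
    (t.1.1.1 < t.2.1 ∨ t.2.1 < t.1.1.1 ∧ w.1 < t.2.1 ∧
      crossingHeight t.1.1 t.1.2 < w.1 * crossing t.1.1 t.1.2 + w.2))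

theorem measurableSet_isRelay :
    MeasurableSet {u : (((ℝ × ℝ) × (ℝ × ℝ)) × (ℝ × ℝ)) × (ℝ × ℝ) | IsRelay u.1 u.2} := by
  unfold IsRelay crossingHeight crossing
  refine measurableSet_setOfPred.2 ?_
  refine Measurable.or (.and ?_ (.or ?_ (.and ?_ (.and ?_ ?_))))
    (.and ?_ (.or ?_ (.and ?_ (.and ?_ ?_)))) <;>
  exact measurableSet_setOfPred.1 (measurableSet_lt (by fun_prop) (by fun_prop))

section Relay

variable {a b c d : ℝ}

/-- A steeper line through a lower point of the rectangle exists as long as the slope is not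
maximal and the line with the lowest intercept passes below the given height. -/
theorem uniformBox_pos_above {m x y : ℝ} (hm : m ∈ Set.Ioo a b) (hcd : c < d)
    (h : m * x + c < y) : 0 < uniformBox a b c d {w | m < w.1 ∧ w.1 * x + w.2 < y} := by
  have hO : IsOpen {w : ℝ × ℝ | m < w.1 ∧ w.1 * x + w.2 < y} := by
    refine IsOpen.inter (s := {w : ℝ × ℝ | m < w.1}) (t := {w | w.1 * x + w.2 < y}) ?_ ?_ <;>
    exact isOpen_lt (by fun_prop) (by fun_prop)
  have h1 : Tendsto (fun ε : ℝ => (m + ε) * x + (c + ε)) (𝓝[>] 0) (𝓝 (m * x + c)) := by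
    have : Continuous fun ε : ℝ => (m + ε) * x + (c + ε) := by fun_prop
    simpa using (this.tendsto 0).mono_left nhdsWithin_le_nhds
  have h2 := h1.eventually_lt_const h
  have h3 : ∀ᶠ ε in 𝓝[>] (0 : ℝ), ε ∈ Set.Ioo 0 (b - m) := Ioo_mem_nhdsGT (sub_pos.2 hm.2)
  have h4 : ∀ᶠ ε in 𝓝[>] (0 : ℝ), ε ∈ Set.Ioo 0 (d - c) := Ioo_mem_nhdsGT (sub_pos.2 hcd)
  obtain ⟨ε, h3, h4, h5⟩ := (h2.and (h3.and h4)).exists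
  exact uniformBox_pos_of_isOpen hO (w := (m + ε, c + ε)) ⟨by simp [h4.1], h3⟩
    ⟨by linarith [hm.1, h4.1], by linarith [h4.2]⟩ ⟨by linarith [h5.1], by linarith [h5.2]⟩

theorem uniformBox_pos_below {m x y : ℝ} (hm : m ∈ Set.Ioo a b) (hcd : c < d)
    (h : y < m * x + d) : 0 < uniformBox a b c d {w | w.1 < m ∧ y < w.1 * x + w.2} := by
  have hO : IsOpen {w : ℝ × ℝ | w.1 < m ∧ y < w.1 * x + w.2} := by
    refine IsOpen.inter (s := {w : ℝ × ℝ | w.1 < m}) (t := {w | y < w.1 * x + w.2}) ?_ ?_ <;>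
    exact isOpen_lt (by fun_prop) (by fun_prop)
  have h1 : Tendsto (fun ε : ℝ => (m - ε) * x + (d - ε)) (𝓝[>] 0) (𝓝 (m * x + d)) := by
    have : Continuous fun ε : ℝ => (m - ε) * x + (d - ε) := by fun_prop
    simpa using (this.tendsto 0).mono_left nhdsWithin_le_nhds
  have h2 := h1.eventually_const_lt h
  have h3 : ∀ᶠ ε in 𝓝[>] (0 : ℝ), ε ∈ Set.Ioo 0 (m - a) := Ioo_mem_nhdsGT (sub_pos.2 hm.1)
  have h4 : ∀ᶠ ε in 𝓝[>] (0 : ℝ), ε ∈ Set.Ioo 0 (d - c) := Ioo_mem_nhdsGT (sub_pos.2 hcd)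
  obtain ⟨ε, h3, h4, h5⟩ := (h2.and (h3.and h4)).exists
  exact uniformBox_pos_of_isOpen hO (w := (m - ε, d - ε)) ⟨by simp [h4.1], h3⟩
    ⟨by linarith [hm.1, h4.2], by linarith [hm.2, h4.1]⟩
    ⟨by linarith [h5.1, h5.2], by linarith [h5.1]⟩

/-- Almost every triple of lines outside `unreachable` admits a set of relays of positive
measure. -/
theorem ae_isRelay_pos (hab : a < b) (hcd : c < d) :
    ∀ᵐ t ∂(((uniformBox a b c d).prod (uniformBox a b c d)).prod (uniformBox a b c d)),
      t ∉ unreachable c d → 0 < uniformBox a b c d {w | IsRelay t w} := by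
  have := isProbabilityMeasure_uniformBox hab hcd
  set μ := uniformBox a b c d with hμ
  have hbox : ∀ᵐ p ∂μ, p.1 ∈ Set.Ioo a b ∧ p.2 ∈ Set.Ioo c d := ae_mem_box
  have h1 : ∀ᵐ t ∂((μ.prod μ).prod μ), t.1.1.1 ∈ Set.Ioo a b ∧ t.1.1.2 ∈ Set.Ioo c d :=
    (Measure.quasiMeasurePreserving_fst.comp Measure.quasiMeasurePreserving_fst).ae hbox
  have h2 : ∀ᵐ t ∂((μ.prod μ).prod μ), t.2.1 ∈ Set.Ioo a b ∧ t.2.2 ∈ Set.Ioo c d :=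
    Measure.quasiMeasurePreserving_snd.ae hbox
  have h3 : ∀ᵐ t ∂((μ.prod μ).prod μ), t.2.1 ≠ t.1.1.1 := by
    refine (Measure.ae_prod_iff_ae_ae (p := fun t : ((ℝ × ℝ) × (ℝ × ℝ)) × (ℝ × ℝ) =>
      t.2.1 ≠ t.1.1.1) (measurableSet_eq_fun (by fun_prop) (by fun_prop)).compl).2
      (ae_of_all _ fun p => ?_)
    filter_upwards [compl_mem_ae_iff.2
      (measure_fst_eq_zero (ν := uniformIcc a b) (κ := uniformIcc c d) p.1.1)] with r hr
    exact hr
  have h4 : ∀ᵐ t ∂((μ.prod μ).prod μ), t.2.1 * crossing t.1.1 t.1.2 + t.2.2 ≠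
      crossingHeight t.1.1 t.1.2 := by
    refine (Measure.ae_prod_iff_ae_ae (p := fun t : ((ℝ × ℝ) × (ℝ × ℝ)) × (ℝ × ℝ) =>
      t.2.1 * crossing t.1.1 t.1.2 + t.2.2 ≠ crossingHeight t.1.1 t.1.2)
      (measurableSet_eq_fun ?_ ?_).compl).2 (ae_of_all _ fun p => ?_)
    · unfold crossing; fun_prop
    · unfold crossingHeight crossing; fun_prop
    · filter_upwards [compl_mem_ae_iff.2 (measure_line_eq_zero (ν := uniformIcc a b)
        (κ := uniformIcc c d) (crossing p.1 p.2) (crossingHeight p.1 p.2))] with r hr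
      exact hr
  filter_upwards [h1, h2, h3, h4] with t ht1 ht2 ht3 ht4 ht
  obtain ⟨⟨p, q⟩, r⟩ := t
  dsimp only at ht1 ht2 ht3 ht4
  have hv : crossing p q ≤ 0 ∨ interceptThrough p q r ∈ Set.Ioo c d := by
    by_contra! hcon
    exact ht hcon
  have huniv : μ Set.univ = 1 := measure_univ
  have hve : interceptThrough p q r = crossingHeight p q - r.1 * crossing p q := by
    unfold interceptThrough crossingHeight; ring
  -- if `r` passes above the crossing and is steeper than `p`, relays exist once the intercept of
  -- the parallel through the crossing exceeds `c`; to the left of the axis it is even larger than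
  -- the intercept of `p`
  rcases lt_or_gt_of_ne ht4 with h | h <;> rcases lt_or_gt_of_ne ht3 with h' | h'
  · refine lt_of_lt_of_le (uniformBox_pos_below ht2.1 hcd
      (x := crossing p q) (y := crossingHeight p q) ?_)
      (measure_mono fun w hw => Or.inr ⟨h, Or.inr ⟨h', hw.1, hw.2⟩⟩)
    rcases hv with h0 | h0
    · have := ht1.2.2
      unfold crossingHeight
      nlinarith
    · rw [hve] at h0
      linarith [h0.2]
  · refine lt_of_lt_of_le (by rw [huniv]; exact one_pos)
      (measure_mono (s := Set.univ) fun w _ => Or.inr ⟨h, Or.inl h'⟩)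
  · refine lt_of_lt_of_le (by rw [huniv]; exact one_pos)
      (measure_mono (s := Set.univ) fun w _ => Or.inl ⟨h, Or.inl h'⟩)
  · refine lt_of_lt_of_le (uniformBox_pos_above ht2.1 hcd
      (x := crossing p q) (y := crossingHeight p q) ?_)
      (measure_mono fun w hw => Or.inl ⟨h, Or.inr ⟨h', hw.1, hw.2⟩⟩)
    rcases hv with h0 | h0
    · have := ht1.2.1
      unfold crossingHeight
      nlinarith
    · rw [hve] at h0
      linarith [h0.1]

/-- The probability that three lines are not in the unreachable configuration, but none of `m` more
random lines is a relay. -/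
noncomputable def noRelayProb (a b c d : ℝ) (m : ℕ) : ENNReal :=
  ∫⁻ t, (unreachable c d)ᶜ.indicator (fun t => uniformBox a b c d {w | ¬ IsRelay t w} ^ m) t
    ∂(((uniformBox a b c d).prod (uniformBox a b c d)).prod (uniformBox a b c d))

theorem tendsto_noRelayProb (hab : a < b) (hcd : c < d) :
    Tendsto (noRelayProb a b c d) atTop (𝓝 0) := by
  have := isProbabilityMeasure_uniformBox hab hcd
  set μ := uniformBox a b c d with hμ
  have hm : Measurable fun t => μ {w | ¬ IsRelay t w} :=
    measurable_measure_prodMk_left (ν := μ) measurableSet_isRelay.compl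
  have := tendsto_lintegral_of_dominated_convergence (μ := (μ.prod μ).prod μ) (f := fun _ => 0)
    (F := fun m t => (unreachable c d)ᶜ.indicator (fun t => μ {w | ¬ IsRelay t w} ^ m) t)
    (fun _ => 1) (fun m => (hm.pow_const m).indicator (measurableSet_unreachable c d).compl)
    (fun m => ae_of_all _ fun t => ?_) (by simp) ?_
  · rw [lintegral_zero] at this
    exact this
  · exact (Set.indicator_le_self _ _ _).trans (pow_le_one₀ (by simp) prob_le_one)
  · filter_upwards [ae_isRelay_pos hab hcd] with t ht
    by_cases htU : t ∈ unreachable c d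
    · simp [htU]
    · simp only [Set.indicator_of_mem (Set.mem_compl htU)]
      refine ENNReal.tendsto_pow_atTop_nhds_zero_of_lt_one ?_
      have e : {w | ¬ IsRelay t w} = {w | IsRelay t w}ᶜ := rfl
      have hms : MeasurableSet {w | IsRelay t w} := measurable_prodMk_left measurableSet_isRelay
      rw [e, prob_compl_eq_one_sub hms]
      exact ENNReal.sub_lt_self (by simp) (by simp) (ht htU).ne'

end Relay

/-! ### Measurability of the network and of its deliveries -/

section Measurability

variable {n : ℕ}

@[fun_prop]
theorem measurable_crossing_eval (i j : Fin n) :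
    Measurable fun ℓ : Fin n → ℝ × ℝ => crossing (ℓ i) (ℓ j) := by
  unfold crossing; fun_prop

theorem measurableSet_isGMSN (N : RCMSN n) :
    MeasurableSet {ℓ : Fin n → ℝ × ℝ | IsGMSN ℓ N} := by
  have e : {ℓ : Fin n → ℝ × ℝ | IsGMSN ℓ N} = {ℓ | (∀ i j, i ≠ j → ¬ (ℓ i).1 = (ℓ j).1) ∧
      (∀ i j i' j', i ≠ j → i' ≠ j' → ¬ ({i, j} : Finset (Fin n)) = {i', j'} →
        ¬ crossing (ℓ i) (ℓ j) = crossing (ℓ i') (ℓ j')) ∧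
      ∀ s t, s < t → ∀ i j i' j', N.packet s = {i, j} → N.packet t = {i', j'} →
        crossing (ℓ i) (ℓ j) < crossing (ℓ i') (ℓ j')} := by
    ext ℓ
    constructor
    · rintro ⟨h1, h2, h3⟩
      exact ⟨fun i j hij e => hij (h1 e), fun i j i' j' h h' hne e => hne (h2 i j i' j' h h' e), h3⟩
    · rintro ⟨h1, h2, h3⟩
      exact ⟨fun i j e => by_contra fun h => h1 i j h e,
        fun i j i' j' h h' e => by_contra fun hne => h2 i j i' j' h h' hne e, h3⟩
  rw [e]
  refine measurableSet_setOfPred.2 (.and ?_ (.and ?_ ?_))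
  · refine .forall fun i => .forall fun j => .imp measurable_const (.not ?_)
    exact measurableSet_setOfPred.1 (measurableSet_eq_fun (by fun_prop) (by fun_prop))
  · refine .forall fun i => .forall fun j => .forall fun i' => .forall fun j' =>
      .imp measurable_const (.imp measurable_const (.imp measurable_const (.not ?_)))
    exact measurableSet_setOfPred.1 (measurableSet_eq_fun (by fun_prop) (by fun_prop))
  · refine .forall fun s => .forall fun t => .imp measurable_const
      (.forall fun i => .forall fun j => .forall fun i' => .forall fun j' =>
      .imp measurable_const (.imp measurable_const ?_))
    exact measurableSet_setOfPred.1 (measurableSet_lt (by fun_prop) (by fun_prop))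

/-- In the network formed by the lines `ℓ`, the packet `{i, j}` can reach `x`. -/
def Delivers (ℓ : Fin n → ℝ × ℝ) (i j x : Fin n) : Prop :=
  ∃ N : RCMSN n, IsGMSN ℓ N ∧ ∃ k, N.packet k = {i, j} ∧ N.CanReach k x

theorem measurableSet_delivers (i j x : Fin n) :
    MeasurableSet {ℓ : Fin n → ℝ × ℝ | Delivers ℓ i j x} := by
  unfold Delivers
  refine measurableSet_setOfPred.2 (.exists fun N => .and ?_ measurable_const)
  exact measurableSet_setOfPred.1 (measurableSet_isGMSN N)

theorem IsGenericLines.delivers_of_mem {ℓ : Fin n → ℝ × ℝ} (h : IsGenericLines ℓ) {i j x : Fin n}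
    (hij : i ≠ j) (hx : x = i ∨ x = j) : Delivers ℓ i j x := by
  obtain ⟨N, hN, -⟩ := h.existsUnique
  obtain ⟨k, hk⟩ := N.exists_packet_eq hij
  exact ⟨N, hN, k, hk, .of_mem (by rw [hk]; simpa using hx)⟩

theorem IsGenericLines.gmsnCapacity_eq_sum {ℓ : Fin n → ℝ × ℝ} (h : IsGenericLines ℓ) :
    gmsnCapacity ℓ = 1 / ((n : ℝ) * (n.choose 2 : ℝ)) * ((1 / 2) *
      ∑ p ∈ (Finset.univ : Finset (Fin n)).offDiag, ∑ x,
        {ℓ : Fin n → ℝ × ℝ | Delivers ℓ p.1 p.2 x}.indicator 1 ℓ) := by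
  classical
  obtain ⟨N, hN, -⟩ := h.existsUnique
  have hd : ∀ i j x, Delivers ℓ i j x ↔ ∃ k, N.packet k = {i, j} ∧ N.CanReach k x := by
    intro i j x
    constructor
    · rintro ⟨N', hN', h'⟩
      rwa [hN'.unique hN] at h'
    · exact fun h' => ⟨N, hN, h'⟩
  rw [hN.gmsnCapacity_eq, CMSN.capacity]
  congr 1
  have := N.two_mul_sum_packet fun s => ∑ x, if ∃ k, N.packet k = s ∧ N.CanReach k x then 1 else 0
  have h1 : ∀ k, (Set.ncard {x : Fin n | N.CanReach k x} : ℝ) =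
      ∑ x, if ∃ k', N.packet k' = N.packet k ∧ N.CanReach k' x then (1 : ℝ) else 0 := by
    intro k
    have : ∀ x, (∃ k', N.packet k' = N.packet k ∧ N.CanReach k' x) ↔ N.CanReach k x := by
      intro x
      constructor
      · rintro ⟨k', hk', hx⟩
        rwa [N.packet_injective hk'] at hx
      · exact fun hx => ⟨k, rfl, hx⟩
    simp only [this]
    rw [Finset.sum_boole, Set.ncard_eq_toFinset_card']
    congr 2
    ext; simp
  simp only [h1]
  rw [← mul_right_inj' (two_ne_zero (α := ℝ)), this, ← mul_assoc, mul_one_div_cancel two_ne_zero,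
    one_mul]
  refine Finset.sum_congr rfl fun p _ => Finset.sum_congr rfl fun x _ => ?_
  rw [Set.indicator_apply]
  simp [hd]

end Measurability

/-! ### Independent lines -/

section Independent

variable {n : ℕ} {μ : Measure (ℝ × ℝ)} [IsProbabilityMeasure μ]

theorem iIndepFun_eval_pi :
    iIndepFun (fun (i : Fin n) (ℓ : Fin n → ℝ × ℝ) => ℓ i) (Measure.pi fun _ => μ) :=
  iIndepFun_pi (X := fun _ => id) fun _ => aemeasurable_id

theorem indepFun_triple_restrict {T : Finset (Fin n)} {i j k : Fin n} (hi : i ∉ T) (hj : j ∉ T)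
    (hk : k ∉ T) :
    IndepFun (fun ℓ : Fin n → ℝ × ℝ => ((ℓ i, ℓ j), ℓ k)) T.restrict (Measure.pi fun _ => μ) := by
  have hd : Disjoint ({i, j, k} : Finset (Fin n)) T := by
    simp [Finset.disjoint_left, hi, hj, hk]
  have h := iIndepFun_eval_pi (μ := μ).indepFun_finset _ T hd (fun i => measurable_pi_apply i)
  exact h.comp (φ := fun u : ({i, j, k} : Finset (Fin n)) → ℝ × ℝ =>
    ((u ⟨i, by simp⟩, u ⟨j, by simp⟩), u ⟨k, by simp⟩)) (ψ := id) (by fun_prop) measurable_id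

theorem map_restrict_pi (T : Finset (Fin n)) :
    (Measure.pi fun _ : Fin n => μ).map T.restrict = Measure.pi fun _ : T => μ := by
  have h := (iIndepFun_eval_pi (n := n) (μ := μ)).precomp (g := fun i : T => (i : Fin n))
    Subtype.val_injective
  have h' := h.map_fun_eq_pi_map (fun i => (measurable_pi_apply _).aemeasurable)
  refine h'.trans ?_
  congr 1
  funext i
  exact (measurePreserving_eval (fun _ : Fin n => μ) i).map_eq

theorem map_triple_pi {i j k : Fin n} (hij : i ≠ j) (hik : i ≠ k) (hjk : j ≠ k) :
    (Measure.pi fun _ : Fin n => μ).map (fun ℓ => ((ℓ i, ℓ j), ℓ k)) = (μ.prod μ).prod μ := by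
  have hI := iIndepFun_eval_pi (n := n) (μ := μ)
  have hm := fun i : Fin n => measurable_pi_apply (X := fun _ : Fin n => ℝ × ℝ) i
  have he : ∀ i, (Measure.pi fun _ : Fin n => μ).map (fun ℓ => ℓ i) = μ := fun i =>
    (measurePreserving_eval (fun _ : Fin n => μ) i).map_eq
  have h1 := (indepFun_iff_map_prod_eq_prod_map_map ((hm i).prodMk (hm j)).aemeasurable
    (hm k).aemeasurable).1 (hI.indepFun_prodMk hm i j k hik hjk)
  have h2 := (indepFun_iff_map_prod_eq_prod_map_map (hm i).aemeasurable
    (hm j).aemeasurable).1 (hI.indepFun hij)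
  rw [he, he] at h2
  rw [h2, he] at h1
  exact h1

theorem map_triple_restrict_pi {T : Finset (Fin n)} {i j k : Fin n} (hi : i ∉ T) (hj : j ∉ T)
    (hk : k ∉ T) (hij : i ≠ j) (hik : i ≠ k) (hjk : j ≠ k) :
    (Measure.pi fun _ : Fin n => μ).map (fun ℓ => (((ℓ i, ℓ j), ℓ k), T.restrict ℓ)) =
      ((μ.prod μ).prod μ).prod (Measure.pi fun _ : T => μ) := by
  rw [(indepFun_iff_map_prod_eq_prod_map_map (by fun_prop)
    (Finset.measurable_restrict T).aemeasurable).1 (indepFun_triple_restrict hi hj hk),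
    map_triple_pi hij hik hjk, map_restrict_pi]

/-- If all sections of `A` are null, then the line `m`, being independent of three other lines,
almost surely avoids the section that belongs to these lines. -/
theorem ae_triple_eval_notMem {A : Set ((((ℝ × ℝ) × (ℝ × ℝ)) × (ℝ × ℝ)) × (ℝ × ℝ))}
    (hAm : MeasurableSet A) (hA : ∀ t, μ (Prod.mk t ⁻¹' A) = 0) {i j k m : Fin n} (hi : i ≠ m)
    (hj : j ≠ m) (hk : k ≠ m) :
    ∀ᵐ ℓ ∂(Measure.pi fun _ : Fin n => μ), (((ℓ i, ℓ j), ℓ k), ℓ m) ∉ A := by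
  have hI : IndepFun (fun ℓ : Fin n → ℝ × ℝ => ((ℓ i, ℓ j), ℓ k)) (fun ℓ => ℓ m)
      (Measure.pi fun _ => μ) :=
    (indepFun_triple_restrict (T := {m}) (by simpa using hi) (by simpa using hj)
      (by simpa using hk)).comp (φ := id) (ψ := fun u : ({m} : Finset (Fin n)) → ℝ × ℝ =>
      u ⟨m, by simp⟩) measurable_id (by fun_prop)
  have h1 := (indepFun_iff_map_prod_eq_prod_map_map (by fun_prop)
    (measurable_pi_apply m).aemeasurable).1 hI
  have he : (Measure.pi fun _ : Fin n => μ).map (fun ℓ => ℓ m) = μ :=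
    (measurePreserving_eval (fun _ : Fin n => μ) m).map_eq
  rw [he] at h1
  have h2 : ((Measure.pi fun _ : Fin n => μ).map fun ℓ => (((ℓ i, ℓ j), ℓ k), ℓ m)) A = 0 := by
    rw [h1, Measure.measure_prod_null hAm]
    exact ae_of_all _ hA
  exact ae_of_ae_map (p := fun u => u ∉ A) (by fun_prop) (compl_mem_ae_iff.2 h2)

end Independent

/-! ### The expected capacity -/

section Expectation

variable {a b c d : ℝ} {n : ℕ}

theorem ae_isGenericLines (hab : a < b) (hcd : c < d) :
    ∀ᵐ ℓ ∂(Measure.pi fun _ : Fin n => uniformBox a b c d), IsGenericLines ℓ := by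
  have := isProbabilityMeasure_uniformBox hab hcd
  set μ := uniformBox a b c d with hμ
  have h1 : ∀ i j : Fin n, ∀ᵐ ℓ ∂(Measure.pi fun _ : Fin n => μ),
      i ≠ j → (ℓ j).1 ≠ (ℓ i).1 := by
    intro i j
    by_cases hij : i = j
    · simp [hij]
    · have hA : MeasurableSet {u : (((ℝ × ℝ) × (ℝ × ℝ)) × (ℝ × ℝ)) × (ℝ × ℝ) |
          u.2.1 = u.1.1.1.1} := measurableSet_eq_fun (by fun_prop) (by fun_prop)
      filter_upwards [ae_triple_eval_notMem (μ := μ) hA (fun t =>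
        measure_fst_eq_zero (ν := uniformIcc a b) (κ := uniformIcc c d) t.1.1.1) hij hij hij]
        with ℓ hℓ _ using hℓ
  have h2 : ∀ i j i' j' : Fin n, ∀ᵐ ℓ ∂(Measure.pi fun _ : Fin n => μ),
      i ≠ j' → j ≠ j' → i' ≠ j' → crossing (ℓ i') (ℓ j') ≠ crossing (ℓ i) (ℓ j) := by
    intro i j i' j'
    by_cases hi : i = j'
    · simp [hi]
    by_cases hj : j = j'
    · simp [hj]
    by_cases hi' : i' = j'
    · simp [hi']
    have hA : MeasurableSet {u : (((ℝ × ℝ) × (ℝ × ℝ)) × (ℝ × ℝ)) × (ℝ × ℝ) |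
        crossing u.1.2 u.2 = crossing u.1.1.1 u.1.1.2} := by
      unfold crossing
      exact measurableSet_eq_fun (by fun_prop) (by fun_prop)
    filter_upwards [ae_triple_eval_notMem (μ := μ) hA (fun t =>
      measure_crossing_eq_zero (ν := uniformIcc a b) (κ := uniformIcc c d) t.2
        (crossing t.1.1 t.1.2)) hi hj hi'] with ℓ hℓ _ _ _ using hℓ
  simp only [← ae_all_iff] at h1 h2
  filter_upwards [h1, h2] with ℓ h1 h2
  refine ⟨fun i j e => by_contra fun h => h1 j i (Ne.symm h) e, ?_⟩
  intro i j i' j' hij hij' e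
  by_cases hj : j' = i ∨ j' = j
  · by_cases hi : i' = i ∨ i' = j
    · rcases hi with rfl | rfl <;> rcases hj with rfl | rfl
      · exact absurd rfl hij'
      · rfl
      · exact Finset.pair_comm _ _
      · exact absurd rfl hij'
    · push Not at hi
      rw [crossing_comm (ℓ i')] at e
      exact absurd e.symm (h2 i j j' i' hi.1.symm hi.2.symm hij'.symm)
  · push Not at hj
    exact absurd e.symm (h2 i j i' j' hj.1.symm hj.2.symm hij')

theorem ae_forall_mem_box (hab : a < b) (hcd : c < d) :
    ∀ᵐ ℓ ∂(Measure.pi fun _ : Fin n => uniformBox a b c d), ∀ i, (ℓ i).2 ∈ Set.Ioo c d := by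
  have := isProbabilityMeasure_uniformBox hab hcd
  refine ae_all_iff.2 fun i => ?_
  filter_upwards [(measurePreserving_eval (fun _ : Fin n => uniformBox a b c d)
    i).quasiMeasurePreserving.ae ae_mem_box] with ℓ hℓ using hℓ.2

theorem Delivers.notMem_unreachable {ℓ : Fin n → ℝ × ℝ} (hbox : ∀ i, (ℓ i).2 ∈ Set.Ioo c d)
    {i j x : Fin n} (hij : i ≠ j) (h : Delivers ℓ i j x) :
    ((ℓ i, ℓ j), ℓ x) ∉ unreachable c d := by
  rintro ⟨h0, hv⟩
  obtain ⟨N, hN, k, hk, hx⟩ := h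
  have h1 := hN.lt_interceptThrough_of_canReach (s := 1) (c := c)
    (fun w => by linarith [(hbox w).1]) hij h0 hk hx
  have h2 := hN.lt_interceptThrough_of_canReach (s := -1) (c := -d)
    (fun w => by linarith [(hbox w).2]) hij h0 hk hx
  exact hv ⟨by linarith, by linarith⟩

theorem IsGenericLines.delivers_of_isRelay {ℓ : Fin n → ℝ × ℝ} (h : IsGenericLines ℓ)
    {i j x w : Fin n} (hij : i ≠ j) (hw : IsRelay ((ℓ i, ℓ j), ℓ x) (ℓ w)) :
    Delivers ℓ i j x := by
  obtain ⟨N, hN, -⟩ := h.existsUnique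
  obtain ⟨k, hk⟩ := N.exists_packet_eq hij
  refine ⟨N, hN, k, hk, ?_⟩
  rcases hw with ⟨h1, h2 | ⟨h2, h3, h4⟩⟩ | ⟨h1, h2 | ⟨h2, h3, h4⟩⟩
  · exact hN.canReach_direct (s := 1) (.inl rfl) hk (by simpa using h1) (by simpa using h2)
  · exact hN.canReach_relay (s := 1) (.inl rfl) hk (by simpa using h1) (by simpa using h2)
      (w := w) (by simpa using h3) (by simpa using h4)
  · refine hN.canReach_direct (s := -1) (.inr rfl) hk ?_ ?_ <;>
    · rw [neg_one_mul, neg_one_mul, neg_lt_neg_iff]; assumption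
  · refine hN.canReach_relay (s := -1) (.inr rfl) hk (w := w) ?_ ?_ ?_ ?_ <;>
    · rw [neg_one_mul, neg_one_mul, neg_lt_neg_iff]; assumption

theorem measure_triple_notMem_unreachable (hab : a < b) (hcd : c < d) {i j x : Fin n} (hij : i ≠ j)
    (hix : i ≠ x) (hjx : j ≠ x) :
    (Measure.pi fun _ : Fin n => uniformBox a b c d).real
      {ℓ | ((ℓ i, ℓ j), ℓ x) ∉ unreachable c d} = 5 / 6 := by
  have := isProbabilityMeasure_uniformBox hab hcd
  have hU := measurableSet_unreachable c d
  have e : {ℓ : Fin n → ℝ × ℝ | ((ℓ i, ℓ j), ℓ x) ∉ unreachable c d} =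
    (fun ℓ => ((ℓ i, ℓ j), ℓ x)) ⁻¹' (unreachable c d)ᶜ := rfl
  rw [e, ← map_measureReal_apply (by fun_prop) hU.compl, map_triple_pi hij hix hjx,
    probReal_compl_eq_one_sub hU, measureReal_def, measure_unreachable hab hcd]
  norm_num

theorem measure_noRelay (hab : a < b) (hcd : c < d) {i j x : Fin n} (hij : i ≠ j)
    (hix : i ≠ x) (hjx : j ≠ x) :
    (Measure.pi fun _ : Fin n => uniformBox a b c d)
      {ℓ | ((ℓ i, ℓ j), ℓ x) ∉ unreachable c d ∧
        ∀ w : (({i, j, x}ᶜ : Finset (Fin n))), ¬ IsRelay ((ℓ i, ℓ j), ℓ x) (ℓ w)} =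
      noRelayProb a b c d (n - 3) := by
  have := isProbabilityMeasure_uniformBox hab hcd
  set μ := uniformBox a b c d with hμ
  set T : Finset (Fin n) := {i, j, x}ᶜ with hT
  have hcard : Fintype.card T = n - 3 := by
    rw [Fintype.card_coe, hT, Finset.card_compl, Fintype.card_fin,
      Finset.card_eq_three.2 ⟨i, j, x, hij, hix, hjx, rfl⟩]
  set B : Set ((((ℝ × ℝ) × (ℝ × ℝ)) × (ℝ × ℝ)) × (T → ℝ × ℝ)) :=
    {u | u.1 ∉ unreachable c d ∧ ∀ w, ¬ IsRelay u.1 (u.2 w)} with hB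
  have hBm : MeasurableSet B := by
    refine measurableSet_setOfPred.2 (.and ?_ (.forall fun w => .not ?_))
    · exact measurableSet_setOfPred.1 (measurable_fst (measurableSet_unreachable c d).compl)
    · have hf : Measurable fun u : (((ℝ × ℝ) × (ℝ × ℝ)) × (ℝ × ℝ)) × (T → ℝ × ℝ) =>
        (u.1, u.2 w) := by fun_prop
      exact measurableSet_setOfPred.1 (hf measurableSet_isRelay)
  have e : {ℓ : Fin n → ℝ × ℝ | ((ℓ i, ℓ j), ℓ x) ∉ unreachable c d ∧
      ∀ w : T, ¬ IsRelay ((ℓ i, ℓ j), ℓ x) (ℓ w)} =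
      (fun ℓ => (((ℓ i, ℓ j), ℓ x), T.restrict ℓ)) ⁻¹' B := rfl
  rw [e, ← Measure.map_apply (by fun_prop) hBm, map_triple_restrict_pi (by simp [hT])
    (by simp [hT]) (by simp [hT]) hij hix hjx, Measure.prod_apply hBm, noRelayProb]
  refine lintegral_congr fun t => ?_
  by_cases ht : t ∈ unreachable c d
  · have : Prod.mk t ⁻¹' B = ∅ := by ext; simp [hB, ht]
    simp [this, ht]
  · have : Prod.mk t ⁻¹' B = Set.pi Set.univ fun _ => {w | ¬ IsRelay t w} := by
      ext u; simp [hB, ht]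
    rw [this, Measure.pi_pi, Finset.prod_const, Finset.card_univ, hcard,
      Set.indicator_of_mem (Set.mem_compl ht)]

theorem measure_delivers_le (hab : a < b) (hcd : c < d) {i j x : Fin n} (hij : i ≠ j)
    (hix : i ≠ x) (hjx : j ≠ x) :
    (Measure.pi fun _ : Fin n => uniformBox a b c d).real {ℓ | Delivers ℓ i j x} ≤ 5 / 6 := by
  have := isProbabilityMeasure_uniformBox hab hcd
  rw [← measure_triple_notMem_unreachable hab hcd hij hix hjx]
  refine ENNReal.toReal_mono (measure_ne_top _ _) (measure_mono_ae ?_)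
  filter_upwards [ae_forall_mem_box hab hcd] with ℓ hℓ h
  exact Delivers.notMem_unreachable hℓ hij h

theorem le_measure_delivers (hab : a < b) (hcd : c < d) {i j x : Fin n} (hij : i ≠ j)
    (hix : i ≠ x) (hjx : j ≠ x) :
    5 / 6 - (noRelayProb a b c d (n - 3)).toReal ≤
      (Measure.pi fun _ : Fin n => uniformBox a b c d).real {ℓ | Delivers ℓ i j x} := by
  have := isProbabilityMeasure_uniformBox hab hcd
  rw [← measure_triple_notMem_unreachable hab hcd hij hix hjx, ← measure_noRelay hab hcd hij hix hjx,
    sub_le_iff_le_add, ← measureReal_def]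
  refine le_trans ?_ (measureReal_union_le _ _)
  refine ENNReal.toReal_mono (measure_ne_top _ _) (measure_mono_ae ?_)
  filter_upwards [ae_isGenericLines hab hcd] with ℓ hℓ h
  by_cases hw : ∃ w : (({i, j, x}ᶜ : Finset (Fin n))), IsRelay ((ℓ i, ℓ j), ℓ x) (ℓ w)
  · obtain ⟨w, hw⟩ := hw
    exact Or.inl (hℓ.delivers_of_isRelay hij hw)
  · push Not at hw
    exact Or.inr ⟨h, hw⟩

theorem measure_delivers_of_mem (hab : a < b) (hcd : c < d) {i j x : Fin n} (hij : i ≠ j)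
    (hx : x = i ∨ x = j) :
    (Measure.pi fun _ : Fin n => uniformBox a b c d).real {ℓ | Delivers ℓ i j x} = 1 := by
  have := isProbabilityMeasure_uniformBox hab hcd
  rw [measureReal_def, (mem_ae_iff_prob_eq_one (measurableSet_delivers i j x)).1]
  · simp
  · filter_upwards [ae_isGenericLines hab hcd] with ℓ hℓ
    exact hℓ.delivers_of_mem hij hx

/-- For a fixed packet, the sensors that are not in it count `n - 2` times. -/
theorem sum_measure_delivers_bounds (hab : a < b) (hcd : c < d) {i j : Fin n} (hij : i ≠ j) :
    2 + ((n : ℝ) - 2) * (5 / 6 - (noRelayProb a b c d (n - 3)).toReal) ≤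
      ∑ x, (Measure.pi fun _ : Fin n => uniformBox a b c d).real {ℓ | Delivers ℓ i j x} ∧
    ∑ x, (Measure.pi fun _ : Fin n => uniformBox a b c d).real {ℓ | Delivers ℓ i j x} ≤
      2 + ((n : ℝ) - 2) * (5 / 6) := by
  have hcard : ((({i, j} : Finset (Fin n))ᶜ.card : ℕ) : ℝ) = (n : ℝ) - 2 := by
    rw [Finset.card_compl, Finset.card_pair hij, Fintype.card_fin, Nat.cast_sub]
    · simp
    · simpa [Finset.card_pair hij] using Finset.card_le_univ ({i, j} : Finset (Fin n))
  rw [← Finset.sum_add_sum_compl {i, j}, Finset.sum_pair hij,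
    measure_delivers_of_mem hab hcd hij (.inl rfl), measure_delivers_of_mem hab hcd hij (.inr rfl),
    one_add_one_eq_two, add_le_add_iff_left, add_le_add_iff_left, ← hcard, ← nsmul_eq_mul,
    ← nsmul_eq_mul]
  constructor
  · refine Finset.card_nsmul_le_sum _ _ _ fun x hx => ?_
    have : ¬ (x = i ∨ x = j) := by simpa using hx
    push Not at this
    exact le_measure_delivers hab hcd hij this.1.symm this.2.symm
  · refine Finset.sum_le_card_nsmul _ _ _ fun x hx => ?_
    have : ¬ (x = i ∨ x = j) := by simpa using hx
    push Not at this
    exact measure_delivers_le hab hcd hij this.1.symm this.2.symm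

theorem gmsnCapacity_ae_eq (hab : a < b) (hcd : c < d) :
    (gmsnCapacity : (Fin n → ℝ × ℝ) → ℝ) =ᵐ[Measure.pi fun _ => uniformBox a b c d] fun ℓ =>
      1 / ((n : ℝ) * (n.choose 2 : ℝ)) * ((1 / 2) *
      ∑ p ∈ (Finset.univ : Finset (Fin n)).offDiag, ∑ x,
        {ℓ : Fin n → ℝ × ℝ | Delivers ℓ p.1 p.2 x}.indicator 1 ℓ) := by
  filter_upwards [ae_isGenericLines hab hcd] with ℓ hℓ using hℓ.gmsnCapacity_eq_sum

theorem integrable_indicator_delivers (hab : a < b) (hcd : c < d) (i j x : Fin n) :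
    Integrable ({ℓ : Fin n → ℝ × ℝ | Delivers ℓ i j x}.indicator (1 : (Fin n → ℝ × ℝ) → ℝ))
      (Measure.pi fun _ => uniformBox a b c d) := by
  have := isProbabilityMeasure_uniformBox hab hcd
  exact (integrable_const (1 : ℝ)).indicator (measurableSet_delivers i j x)

theorem integrable_gmsnCapacity (hab : a < b) (hcd : c < d) :
    Integrable (gmsnCapacity : (Fin n → ℝ × ℝ) → ℝ) (Measure.pi fun _ => uniformBox a b c d) := by
  refine Integrable.congr (Integrable.const_mul (Integrable.const_mul ?_ _) _)
    (gmsnCapacity_ae_eq hab hcd).symm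
  exact integrable_finsetSum _ fun p _ => integrable_finsetSum _ fun x _ =>
    integrable_indicator_delivers hab hcd _ _ _

theorem integral_gmsnCapacity (hab : a < b) (hcd : c < d) :
    ∫ ℓ : Fin n → ℝ × ℝ, gmsnCapacity ℓ ∂(Measure.pi fun _ => uniformBox a b c d) =
      1 / ((n : ℝ) * (n.choose 2 : ℝ)) * ((1 / 2) *
      ∑ p ∈ (Finset.univ : Finset (Fin n)).offDiag, ∑ x,
        (Measure.pi fun _ : Fin n => uniformBox a b c d).real {ℓ | Delivers ℓ p.1 p.2 x}) := by
  rw [integral_congr_ae (gmsnCapacity_ae_eq hab hcd), integral_const_mul, integral_const_mul,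
    integral_finsetSum _ fun p _ => integrable_finsetSum _ fun x _ =>
      integrable_indicator_delivers hab hcd _ _ _]
  congr 2
  refine Finset.sum_congr rfl fun p _ => ?_
  rw [integral_finsetSum _ fun x _ => integrable_indicator_delivers hab hcd _ _ _]
  exact Finset.sum_congr rfl fun x _ => integral_indicator_one (measurableSet_delivers _ _ _)

theorem integral_gmsnCapacity_bounds (hab : a < b) (hcd : c < d) (hn : 2 ≤ n) :
    (2 + ((n : ℝ) - 2) * (5 / 6 - (noRelayProb a b c d (n - 3)).toReal)) / n ≤
      ∫ ℓ : Fin n → ℝ × ℝ, gmsnCapacity ℓ ∂(Measure.pi fun _ => uniformBox a b c d) ∧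
    ∫ ℓ : Fin n → ℝ × ℝ, gmsnCapacity ℓ ∂(Measure.pi fun _ => uniformBox a b c d) ≤
      (2 + ((n : ℝ) - 2) * (5 / 6)) / n := by
  have hn' : (2 : ℝ) ≤ n := by exact_mod_cast hn
  have hcard : (((Finset.univ : Finset (Fin n)).offDiag.card : ℕ) : ℝ) = n * (n - 1) := by
    rw [Finset.offDiag_card, Finset.card_univ, Fintype.card_fin, Nat.cast_sub (Nat.le_mul_self n)]
    push_cast; ring
  have hfac : ∀ y : ℝ, 1 / ((n : ℝ) * (n.choose 2 : ℝ)) * ((1 / 2) * (n * (n - 1) * y)) = y / n := by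
    intro y
    rw [Nat.cast_choose_two]
    have : (n : ℝ) - 1 ≠ 0 := by linarith
    field_simp
  have hpos : 0 ≤ 1 / ((n : ℝ) * (n.choose 2 : ℝ)) := by positivity
  rw [integral_gmsnCapacity hab hcd, ← hfac, ← hfac, ← hcard]
  have hp : ∀ p ∈ (Finset.univ : Finset (Fin n)).offDiag, p.1 ≠ p.2 := fun p hp => by simpa using hp
  constructor
  · gcongr
    rw [← nsmul_eq_mul]
    exact Finset.card_nsmul_le_sum _ _ _ fun p h => (sum_measure_delivers_bounds hab hcd (hp p h)).1
  · gcongr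
    rw [← nsmul_eq_mul]
    exact Finset.sum_le_card_nsmul _ _ _ fun p h => (sum_measure_delivers_bounds hab hcd (hp p h)).2

theorem tendsto_integral_gmsnCapacity (hab : a < b) (hcd : c < d) :
    Tendsto (fun n : ℕ => ∫ ℓ : Fin n → ℝ × ℝ, gmsnCapacity ℓ
      ∂(Measure.pi fun _ => uniformBox a b c d)) atTop (𝓝 (5 / 6)) := by
  have h1 : Tendsto (fun n : ℕ => (2 : ℝ) / n) atTop (𝓝 0) :=
    tendsto_const_div_atTop_nhds_zero_nat 2
  have h2 : Tendsto (fun n : ℕ => (noRelayProb a b c d (n - 3)).toReal) atTop (𝓝 0) := by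
    have := (tendsto_noRelayProb hab hcd).comp (tendsto_sub_atTop_nat 3)
    exact (ENNReal.tendsto_toReal ENNReal.zero_ne_top).comp this
  have h3 : ∀ e : ℕ → ℝ, Tendsto e atTop (𝓝 0) →
      Tendsto (fun n : ℕ => (2 + ((n : ℝ) - 2) * (5 / 6 - e n)) / n) atTop (𝓝 (5 / 6)) := by
    intro e he
    have h4 : Tendsto (fun n : ℕ => (2 : ℝ) / n + (1 - 2 / n) * (5 / 6 - e n)) atTop
        (𝓝 (0 + (1 - 0) * (5 / 6 - 0))) :=
      h1.add ((tendsto_const_nhds.sub h1).mul (tendsto_const_nhds.sub he))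
    have h5 : (0 : ℝ) + (1 - 0) * (5 / 6 - 0) = 5 / 6 := by norm_num
    rw [h5] at h4
    refine h4.congr' ?_
    filter_upwards [eventually_gt_atTop 0] with n hn
    have : (n : ℝ) ≠ 0 := by exact_mod_cast hn.ne'
    field_simp
  refine tendsto_of_tendsto_of_tendsto_of_le_of_le' (h3 _ h2) (h3 (fun _ => 0) tendsto_const_nhds)
    ?_ ?_
  · filter_upwards [eventually_ge_atTop 2] with n hn
    exact (integral_gmsnCapacity_bounds hab hcd hn).1
  · filter_upwards [eventually_ge_atTop 2] with n hn
    simpa only [sub_zero] using (integral_gmsnCapacity_bounds hab hcd hn).2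

end Expectation

theorem mainTheorem1 (aMin aMax bMin bMax : ℝ) (ha : aMin < aMax) (hb : bMin < bMax)
    {Ω : ℕ → Type*} [∀ n, MeasurableSpace (Ω n)]
    (P : ∀ n, Measure (Ω n)) [∀ n, IsProbabilityMeasure (P n)]
    (X : ∀ n, Fin n → Ω n → ℝ × ℝ)
    (hindep : ∀ n, iIndepFun (X n) (P n))
    (hunif : ∀ n k, pdf.IsUniform (X n k) (Set.Icc aMin aMax ×ˢ Set.Icc bMin bMax) (P n) volume) :
    (∀ n, ∀ᵐ ω ∂(P n), ∃! N : RCMSN n, IsGMSN (fun k => X n k ω) N) ∧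
    (∀ n, Integrable (fun ω => gmsnCapacity fun k => X n k ω) (P n)) ∧
    Tendsto (fun n => ∫ ω, gmsnCapacity (fun k => X n k ω) ∂(P n)) atTop (𝓝 (5 / 6)) := by
  have hlaw : ∀ n k, (P n).map (X n k) = uniformBox aMin aMax bMin bMax := fun n k =>
    (hunif n k).trans (cond_volume_prod_Icc ha hb)
  have hX : ∀ n k, AEMeasurable (X n k) (P n) := fun n k => by
    have := isProbabilityMeasure_uniformBox ha hb
    refine AEMeasurable.of_map_ne_zero ?_
    rw [hlaw]
    exact IsProbabilityMeasure.ne_zero _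
  have hX' : ∀ n, AEMeasurable (fun ω k => X n k ω) (P n) := fun n => aemeasurable_pi_lambda _ (hX n)
  have hmap : ∀ n, (P n).map (fun ω k => X n k ω) =
      Measure.pi fun _ => uniformBox aMin aMax bMin bMax := by
    intro n
    rw [(hindep n).map_fun_eq_pi_map (hX n)]
    simp only [hlaw]
  have hint : ∀ n, Integrable (gmsnCapacity : (Fin n → ℝ × ℝ) → ℝ)
      ((P n).map (fun ω k => X n k ω)) := fun n => by
    rw [hmap]
    exact integrable_gmsnCapacity ha hb
  refine ⟨fun n => ?_, fun n => (hint n).comp_aemeasurable (hX' n), ?_⟩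
  · refine ae_of_ae_map (hX' n) (p := fun ℓ => ∃! N : RCMSN n, IsGMSN ℓ N) ?_
    rw [hmap]
    filter_upwards [ae_isGenericLines ha hb] with ℓ hℓ using hℓ.existsUnique
  · refine (tendsto_integral_gmsnCapacity ha hb).congr fun n => ?_
    rw [← hmap n]
    exact integral_map (hX' n) (hint n).aestronglyMeasurable
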